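/- Let $n>2$ be an integer, $0<\mu<n$, $0<q<1$, $2^*_\mu=\frac{2n-\mu}{n-2}$, and let $\Omega\subset\mathbb R^n$ be a bounded domain (a nonempty, open, connected, bounded set; in particular every bounded domain with smooth boundary is allowed). Let $H_{+,q}$ be the set of all $u\in H^1_0(\Omega)$ with $u\ge 0$ a.e., $u\not\equiv 0$ and $|u|^{1-q}\in L^1(\Omega)$. For $\lambda>0$, $u\in H^1_0(\Omega)$ put \[ I_\lambda(u)=\frac12\int_\Omega|\nabla u|^2\,dx-\frac{\lambda}{1-q}\int_\Omega|u|^{1-q}\,dx-\frac1{2\cdot 2^*_\mu}\int_\Omega\int_\Omega\frac{|u(x)|^{2^*_\mu}|u(y)|^{2^*_\mu}}{|x-y|^\mu}\,dx\,dy, \] and for $u\in H_{+,q}$ let $\phi_u(t)=I_\lambda(tu)$, $t>0$, be its fiber map. Let \[ S_{H,L}=\inf\left\{\int_{\mathbb R^n}|\nabla u|^2\,dx:\ u\in H^1(\mathbb R^n),\ \int_{\mathbb R^n}\int_{\mathbb R^n}\frac{|u(x)|^{2^*_\mu}|u(y)|^{2^*_\mu}}{|x-y|^\mu}\,dx\,dy=1\right\}.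 \] Let $\Lambda$ be the supremum of the set of all $\lambda>0$ such that (a) for each $u\in H_{+,q}$ the map $\phi_u$ has exactly two critical points in $(0,\infty)$, and (b) $\displaystyle\sup\left\{\int_\Omega|\nabla u|^2\,dx:\ u\in H_{+,q},\ \phi_u'(1)=0,\ \phi_u''(1)>0\right\}\le\left(2^*_\mu\,S_{H,L}^{2^*_\mu}\right)^{\frac1{2^*_\mu-1}}.$ Then this set is nonempty and bounded above, so that $\Lambda$ is a real number, and $\Lambda>0$. -/

import Mathlib

open MeasureTheory Set
open scoped ENNReal ContDiff

noncomputable section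

namespace Choquard

/-- The Euclidean space `ℝⁿ`. -/
abbrev Eucl (n : ℕ) : Type := EuclideanSpace ℝ (Fin n)

/-- `ψ ∈ C_c^∞(Ω)`. -/
structure IsTestFun {n : ℕ} (Ω : Set (Eucl n)) (ψ : Eucl n → ℝ) : Prop where
  smooth : ContDiff ℝ ∞ ψ
  compactSupport : HasCompactSupport ψ
  support_subset : tsupport ψ ⊆ Ω

/-- `g ∈ L²(Ω; ℝⁿ)` is a weak gradient of `u` in `Ω`. -/
structure IsWeakGrad {n : ℕ} (Ω : Set (Eucl n)) (u : Eucl n → ℝ) (g : Eucl n → Eucl n) :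
    Prop where
  memLp : MemLp g 2 (volume.restrict Ω)
  integral_eq : ∀ ψ : Eucl n → ℝ, IsTestFun Ω ψ →
    ∫ x in Ω, u x • gradient ψ x = -∫ x in Ω, ψ x • g x

/-- `u ∈ H¹(Ω)`. Elements of `H¹(Ω)` are represented by functions on `ℝⁿ`; only the almost
everywhere class of the restriction to `Ω` matters below. -/
def MemH1 {n : ℕ} (Ω : Set (Eucl n)) (u : Eucl n → ℝ) : Prop :=
  MemLp u 2 (volume.restrict Ω) ∧ ∃ g, IsWeakGrad Ω u g

open Classical in
/-- The weak gradient of `u` in `Ω` (unique up to null sets when `u ∈ H¹(Ω)`). -/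
def weakGrad {n : ℕ} (Ω : Set (Eucl n)) (u : Eucl n → ℝ) : Eucl n → Eucl n :=
  if h : ∃ g, IsWeakGrad Ω u g then h.choose else 0

/-- `u ∈ H¹₀(Ω)`: `u` lies in the closure of `C_c^∞(Ω)` in `H¹(Ω)`. -/
def MemH10 {n : ℕ} (Ω : Set (Eucl n)) (u : Eucl n → ℝ) : Prop :=
  MemH1 Ω u ∧ ∀ ε : ℝ≥0∞, 0 < ε → ∃ ψ : Eucl n → ℝ, IsTestFun Ω ψ ∧
    eLpNorm (fun x => u x - ψ x) 2 (volume.restrict Ω) < ε ∧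
    eLpNorm (fun x => weakGrad Ω u x - gradient ψ x) 2 (volume.restrict Ω) < ε

/-- `∫_Ω |∇u|² dx`. -/
def dirichlet {n : ℕ} (Ω : Set (Eucl n)) (u : Eucl n → ℝ) : ℝ :=
  ∫ x in Ω, ‖weakGrad Ω u x‖ ^ 2

/-- The critical exponent `2*_μ = (2n - μ)/(n - 2)`. -/
def critExp (n : ℕ) (μ : ℝ) : ℝ := (2 * n - μ) / (n - 2)

/-- `∫_Ω ∫_Ω |u(x)|^{2*_μ} |u(y)|^{2*_μ} / |x - y|^μ dx dy`, as a value in `[0, ∞]`. -/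
def choquard {n : ℕ} (μ : ℝ) (Ω : Set (Eucl n)) (u : Eucl n → ℝ) : ℝ≥0∞ :=
  ∫⁻ x in Ω, ∫⁻ y in Ω,
    ENNReal.ofReal (|u x| ^ critExp n μ * |u y| ^ critExp n μ / ‖x - y‖ ^ μ)

/-- The best constant `S_{H,L}`. -/
def bestConst (n : ℕ) (μ : ℝ) : ℝ :=
  sInf {a | ∃ u : Eucl n → ℝ, MemH1 univ u ∧ choquard μ univ u = 1 ∧ a = dirichlet univ u}

/-- The energy functional `I_λ`. The double integral is finite on `H¹₀(Ω)`. -/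
def energy {n : ℕ} (μ q : ℝ) (Ω : Set (Eucl n)) (l : ℝ) (u : Eucl n → ℝ) : ℝ :=
  1 / 2 * dirichlet Ω u - l / (1 - q) * (∫ x in Ω, |u x| ^ (1 - q))
    - 1 / (2 * critExp n μ) * (choquard μ Ω u).toReal

/-- `u ∈ H_{+,q}`. -/
structure MemHPlus {n : ℕ} (q : ℝ) (Ω : Set (Eucl n)) (u : Eucl n → ℝ) : Prop where
  memH10 : MemH10 Ω u
  nonneg : ∀ᵐ x ∂volume.restrict Ω, 0 ≤ u x
  ne_zero : ¬ ∀ᵐ x ∂volume.restrict Ω, u x = 0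
  integrable : Integrable (fun x => |u x| ^ (1 - q)) (volume.restrict Ω)

/-- The fiber map `φ_u(t) = I_λ(t u)`. -/
def fiber {n : ℕ} (μ q : ℝ) (Ω : Set (Eucl n)) (l : ℝ) (u : Eucl n → ℝ) (t : ℝ) : ℝ :=
  energy μ q Ω l (fun x => t * u x)

/-- The critical points of `φ_u` in `(0, ∞)`. -/
def critPts {n : ℕ} (μ q : ℝ) (Ω : Set (Eucl n)) (l : ℝ) (u : Eucl n → ℝ) : Set ℝ :=
  {t | 0 < t ∧ HasDerivAt (fiber μ q Ω l u) 0 t}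

/-- The functions `u ∈ H_{+,q}` with `φ_u'(1) = 0` and `φ_u''(1) > 0`. -/
def nehariPlus {n : ℕ} (μ q : ℝ) (Ω : Set (Eucl n)) (l : ℝ) : Set (Eucl n → ℝ) :=
  {u | MemHPlus q Ω u ∧ HasDerivAt (fiber μ q Ω l u) 0 1 ∧
    0 < deriv (deriv (fiber μ q Ω l u)) 1}

/-- The set of parameters whose supremum is the threshold `Λ`. The inner supremum is taken in
the extended reals. -/
def admissible {n : ℕ} (μ q : ℝ) (Ω : Set (Eucl n)) : Set ℝ :=
  {l | 0 < l ∧ (∀ u, MemHPlus q Ω u → (critPts μ q Ω l u).encard = 2) ∧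
    sSup ((fun u => (dirichlet Ω u : EReal)) '' nehariPlus μ q Ω l) ≤
      (((critExp n μ * bestConst n μ ^ critExp n μ) ^ (1 / (critExp n μ - 1)) : ℝ) : EReal)}

/-- The threshold `Λ`. -/
def threshold {n : ℕ} (μ q : ℝ) (Ω : Set (Eucl n)) : ℝ := sSup (admissible μ q Ω)

end Choquard

end

open scoped NNReal

noncomputable section

namespace Choquard

open Filter Topology
open scoped Convolution

/-! Write `A`, `B`, `C` for the Dirichlet integral, the integral of `|u|^(1-q)` and the double
integral, and `p = 2*_μ`. For `t > 0` the equation `φ_u'(t) = 0`, multiplied by `t^q`, reads `A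
t^(1+q) - C t^(2p-1+q) = λ B`. In the variable `s = t^(1+q)` the left side is strictly concave and
vanishes at `0`, so there are exactly two solutions as soon as `λ B` lies below one of its values.

Everything is made uniform in `u` by `C ≤ D A^p` (Hardy–Littlewood–Sobolev plus Sobolev) and `B ≤ E
A^((1-q)/2)` (Hölder plus Sobolev). At `t₀ = τ A^(-1/2)` both sides then scale like `A^((1-q)/2)`,
so (a) holds for all small `λ`. If moreover `φ_u'(1) = 0 < φ_u''(1)`, eliminating `C` gives `(2p-2)
A < (2p-1+q) λ B`, hence `A^((1+q)/2) < c λ E`, and (b) holds for small `λ` because its right side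
is positive. That positivity amounts to `S_{H,L} > 0`, which follows from the same inequalities on
all of `H¹(ℝⁿ)`.

For the upper bound one fixed bump function suffices: a critical point forces `t^(2p-2) < A/C` and
`λ B ≤ A t^(1+q)`.

The analytic inputs are `exists_hardyLittlewoodSobolev`, `exists_sobolev_memH10` and
`exists_sobolev_memH1_univ`; the conclusion rests on `encard_solutions_eq_two`,
`exists_mem_admissible` and `bddAbove_admissible`. -/

/-! ### Riesz kernels and the Hardy–Littlewood–Sobolev inequality -/

/-- Rescaling a lower Lebesgue integral over `ℝⁿ`. -/
theorem lintegral_comp_inv_smul {n : ℕ} {R : ℝ} (hR : 0 < R) {G : Eucl n → ℝ≥0∞}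
    (hG : Measurable G) :
    ∫⁻ z, G (R⁻¹ • z) = ENNReal.ofReal (R ^ (n : ℝ)) * ∫⁻ z, G z := by
  have h := Measure.map_addHaar_smul (volume : Measure (Eucl n)) (inv_ne_zero hR.ne')
  rw [← lintegral_map hG (measurable_const_smul _), h, lintegral_smul_measure]
  simp [abs_of_pos hR]

/-- The Riesz kernel `|z|^{-μ}`, `μ < n`, on balls around the origin. -/
theorem exists_lintegral_ball_norm_rpow_le {n : ℕ} (hn : 0 < n) {μ : ℝ} (hμn : μ < n) :
    ∃ C : ℝ≥0, ∀ R : ℝ, 0 < R →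
      ∫⁻ z : Eucl n in Metric.ball 0 R, ENNReal.ofReal (‖z‖ ^ (-μ)) ≤
        C * ENNReal.ofReal (R ^ (n - μ)) := by
  have hint : IntegrableOn (fun z : Eucl n => ‖z‖ ^ (-μ)) (Metric.ball 0 1) volume := by
    refine integrableOn_ball_of_norm_le_rpow (C := 1) (α := μ) (by simpa using Nat.succ_le_of_lt hn)
      (by simpa using hμn) (Filter.Eventually.of_forall fun z => ?_) ?_
    · rw [one_mul, Real.norm_of_nonneg (by positivity)]
    · exact (measurable_norm.pow_const _).aestronglyMeasurable
  have hfin := hint.lintegral_lt_top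
  set C := ∫⁻ z : Eucl n in Metric.ball 0 1, ENNReal.ofReal (‖z‖ ^ (-μ)) with hC
  refine ⟨C.toNNReal, fun R hR => ?_⟩
  rw [ENNReal.coe_toNNReal hfin.ne]
  set G : Eucl n → ℝ≥0∞ :=
    (Metric.ball 0 1).indicator fun z => ENNReal.ofReal (‖z‖ ^ (-μ)) with hGdef
  have hG : Measurable G :=
    (measurable_norm.pow_const _).ennreal_ofReal.indicator measurableSet_ball
  have key := lintegral_comp_inv_smul hR hG
  have h1 : ∫⁻ z, G z = C := lintegral_indicator measurableSet_ball _
  have h2 : ∀ z : Eucl n, (Metric.ball (0 : Eucl n) R).indicator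
      (fun z => ENNReal.ofReal (‖z‖ ^ (-μ))) z = ENNReal.ofReal (R ^ (-μ)) * G (R⁻¹ • z) := by
    intro z
    have hiff : R⁻¹ • z ∈ Metric.ball (0 : Eucl n) 1 ↔ z ∈ Metric.ball (0 : Eucl n) R := by
      simp only [mem_ball_zero_iff, norm_smul, norm_inv, Real.norm_of_nonneg hR.le]
      rw [inv_mul_lt_iff₀ hR, mul_one]
    by_cases hz : z ∈ Metric.ball (0 : Eucl n) R
    · rw [hGdef, indicator_of_mem hz, indicator_of_mem (hiff.2 hz),
        ← ENNReal.ofReal_mul (by positivity), norm_smul, norm_inv, Real.norm_of_nonneg hR.le,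
        ← Real.mul_rpow hR.le (by positivity), mul_inv_cancel_left₀ hR.ne']
    · rw [hGdef, indicator_of_notMem hz, indicator_of_notMem (fun h => hz (hiff.1 h)), mul_zero]
  rw [← lintegral_indicator measurableSet_ball, lintegral_congr h2,
    lintegral_const_mul' _ _ ENNReal.ofReal_ne_top, key, h1, ← mul_assoc,
    ← ENNReal.ofReal_mul (by positivity), ← Real.rpow_add hR, mul_comm]
  exact le_of_eq (by ring_nf)

/-- Tails of `|z|^{-2n}`. -/
theorem exists_lintegral_compl_ball_norm_rpow_le (n : ℕ) (hn : 0 < n) :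
    ∃ C : ℝ≥0, ∀ R : ℝ, 0 < R →
      ∫⁻ z : Eucl n in (Metric.ball 0 R)ᶜ, ENNReal.ofReal (‖z‖ ^ (-(2 * n : ℝ))) ≤
        C * ENNReal.ofReal (R ^ (-n : ℝ)) := by
  have hms : MeasurableSet (Metric.ball (0 : Eucl n) 1)ᶜ := measurableSet_ball.compl
  have hn' : (0 : ℝ) < n := by exact_mod_cast hn
  have hfin : ∫⁻ z : Eucl n in (Metric.ball 0 1)ᶜ, ENNReal.ofReal (‖z‖ ^ (-(2 * n : ℝ))) < ⊤ := by
    have h := finite_integral_one_add_norm (E := Eucl n) (μ := volume) (r := 2 * n)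
      (by simp; linarith)
    -- Off the unit ball `1 + ‖z‖ ≤ 2 ‖z‖`, which accounts for the factor `2^(2n)`.
    refine lt_of_le_of_lt (b := ∫⁻ z : Eucl n, ENNReal.ofReal ((2 : ℝ) ^ (2 * n : ℝ)) *
      ENNReal.ofReal ((1 + ‖z‖) ^ (-(2 * n : ℝ)))) ?_ ?_
    · refine (setLIntegral_mono' hms fun z hz => ?_).trans (setLIntegral_le_lintegral _ _)
      have hz1 : 1 ≤ ‖z‖ := by simpa using hz
      rw [← ENNReal.ofReal_mul (by positivity)]
      apply ENNReal.ofReal_le_ofReal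
      have : (2 : ℝ) ^ (2 * n : ℝ) = (2⁻¹ : ℝ) ^ (-(2 * n : ℝ)) := by
        rw [Real.rpow_neg (by norm_num), Real.inv_rpow (by norm_num), inv_inv]
      rw [this, ← Real.mul_rpow (by positivity) (by positivity)]
      exact Real.rpow_le_rpow_of_nonpos (by positivity) (by linarith) (by linarith)
    · rw [lintegral_const_mul' _ _ ENNReal.ofReal_ne_top]
      exact ENNReal.mul_lt_top ENNReal.ofReal_lt_top h
  set C := ∫⁻ z : Eucl n in (Metric.ball 0 1)ᶜ, ENNReal.ofReal (‖z‖ ^ (-(2 * n : ℝ))) with hC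
  refine ⟨C.toNNReal, fun R hR => ?_⟩
  rw [ENNReal.coe_toNNReal hfin.ne]
  set G : Eucl n → ℝ≥0∞ :=
    (Metric.ball 0 1)ᶜ.indicator fun z => ENNReal.ofReal (‖z‖ ^ (-(2 * n : ℝ))) with hGdef
  have hG : Measurable G :=
    (measurable_norm.pow_const _).ennreal_ofReal.indicator hms
  have key := lintegral_comp_inv_smul hR hG
  have h1 : ∫⁻ z, G z = C := lintegral_indicator hms _
  have h2 : ∀ z : Eucl n, (Metric.ball (0 : Eucl n) R)ᶜ.indicator
      (fun z => ENNReal.ofReal (‖z‖ ^ (-(2 * n : ℝ)))) z =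
        ENNReal.ofReal (R ^ (-(2 * n : ℝ))) * G (R⁻¹ • z) := by
    intro z
    have hiff : R⁻¹ • z ∈ (Metric.ball (0 : Eucl n) 1)ᶜ ↔ z ∈ (Metric.ball (0 : Eucl n) R)ᶜ := by
      simp only [mem_compl_iff, mem_ball_zero_iff, norm_smul, norm_inv, Real.norm_of_nonneg hR.le]
      rw [inv_mul_lt_iff₀ hR, mul_one]
    by_cases hz : z ∈ (Metric.ball (0 : Eucl n) R)ᶜ
    · rw [hGdef, indicator_of_mem hz, indicator_of_mem (hiff.2 hz),
        ← ENNReal.ofReal_mul (by positivity), norm_smul, norm_inv, Real.norm_of_nonneg hR.le,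
        ← Real.mul_rpow hR.le (by positivity), mul_inv_cancel_left₀ hR.ne']
    · rw [hGdef, indicator_of_notMem hz, indicator_of_notMem (fun h => hz (hiff.1 h)), mul_zero]
  rw [← lintegral_indicator measurableSet_ball.compl, lintegral_congr h2,
    lintegral_const_mul' _ _ ENNReal.ofReal_ne_top, key, h1, ← mul_assoc,
    ← ENNReal.ofReal_mul (by positivity), ← Real.rpow_add hR, mul_comm]
  exact le_of_eq (by ring_nf)

/-- Bound of the Riesz potential of a function truncated at the height `a`. -/
theorem exists_lintegral_truncated_potential_le {n : ℕ} (hn : 0 < n) {μ : ℝ} (hμ : 0 < μ)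
    (hμn : μ < n) :
    ∃ C : ℝ≥0, ∀ f : Eucl n → ℝ, Measurable f → (∀ x, 0 ≤ f x) →
      ∫⁻ x, ENNReal.ofReal (f x ^ (2 * n / (2 * n - μ))) ≤ 1 → ∀ (a : ℝ) (x : Eucl n), 0 < a →
      ∫⁻ y in {y | f y ≤ a}, ENNReal.ofReal (f y * ‖x - y‖ ^ (-μ)) ≤
        C * ENNReal.ofReal (a ^ (μ / (2 * n - μ))) := by
  obtain ⟨C₁, hC₁⟩ := exists_lintegral_ball_norm_rpow_le hn hμn
  obtain ⟨C₂, hC₂⟩ := exists_lintegral_compl_ball_norm_rpow_le n hn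
  have hn' : (0 : ℝ) < n := by exact_mod_cast hn
  have hd : 0 < 2 * (n : ℝ) - μ := by linarith
  refine ⟨C₁ + C₂ ^ (μ / (2 * n)), fun f hf hf0 hf1 a x ha => ?_⟩
  -- This radius balances the near part `a R^(n-μ)`, where `f ≤ a`, against the far part `R^(-μ/2)`,
  -- where Hölder is used.
  set R : ℝ := a ^ (-(2 / (2 * n - μ))) with hRdef
  have hR : 0 < R := by positivity
  have hms : MeasurableSet {y | f y ≤ a} := measurableSet_le hf measurable_const
  have hnear : ∫⁻ y in {y | f y ≤ a} ∩ Metric.ball x R, ENNReal.ofReal (f y * ‖x - y‖ ^ (-μ)) ≤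
      C₁ * ENNReal.ofReal (a ^ (μ / (2 * n - μ))) := by
    calc _ ≤ ∫⁻ y in {y | f y ≤ a} ∩ Metric.ball x R,
            ENNReal.ofReal a * ENNReal.ofReal (‖x - y‖ ^ (-μ)) := by
          refine setLIntegral_mono' (hms.inter measurableSet_ball) fun y hy => ?_
          rw [← ENNReal.ofReal_mul ha.le]
          exact ENNReal.ofReal_le_ofReal (mul_le_mul_of_nonneg_right hy.1 (by positivity))
      _ ≤ ∫⁻ y in Metric.ball x R, ENNReal.ofReal a * ENNReal.ofReal (‖x - y‖ ^ (-μ)) :=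
          lintegral_mono_set inter_subset_right
      _ = ENNReal.ofReal a *
            ∫⁻ y in Metric.ball x R, ENNReal.ofReal (‖x - y‖ ^ (-μ)) :=
          lintegral_const_mul' _ _ ENNReal.ofReal_ne_top
      _ = ENNReal.ofReal a *
            ∫⁻ z in Metric.ball (0 : Eucl n) R, ENNReal.ofReal (‖z‖ ^ (-μ)) := by
          congr 1
          rw [← lintegral_indicator measurableSet_ball, ← lintegral_indicator measurableSet_ball,
            ← lintegral_sub_left_eq_self ((Metric.ball (0 : Eucl n) R).indicator _) x]
          congr 1 with y
          simp only [indicator, Metric.mem_ball, dist_eq_norm, norm_sub_rev y x, sub_zero]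
      _ ≤ ENNReal.ofReal a * (C₁ * ENNReal.ofReal (R ^ (n - μ))) := by gcongr; exact hC₁ R hR
      _ = _ := by
          rw [mul_left_comm, ← ENNReal.ofReal_mul ha.le]
          congr 2
          rw [hRdef, ← Real.rpow_mul ha.le, ← Real.rpow_one_add' ha.le]
          · congr 1; field_simp; ring
          · have : 1 + -(2 / (2 * (n : ℝ) - μ)) * (n - μ) = μ / (2 * n - μ) := by field_simp; ring
            rw [this]; positivity
  have hfar : ∫⁻ y in {y | f y ≤ a} ∩ (Metric.ball x R)ᶜ,
      ENNReal.ofReal (f y * ‖x - y‖ ^ (-μ)) ≤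
      (C₂ ^ (μ / (2 * n)) : ℝ≥0) * ENNReal.ofReal (a ^ (μ / (2 * n - μ))) := by
    -- The conjugate exponent `2n/μ` turns the kernel `|z|^(-μ)` into `|z|^(-2n)`, whose tail is of
    -- order `R^(-n)`.
    have hconj : (2 * (n : ℝ) / (2 * n - μ)).HolderConjugate (2 * n / μ) := by
      rw [Real.holderConjugate_iff]
      constructor
      · rw [lt_div_iff₀ hd]; linarith
      · field_simp; ring
    have hmeas1 : Measurable fun y : Eucl n => ENNReal.ofReal (f y) := hf.ennreal_ofReal
    have hmeas2 : Measurable fun y : Eucl n => ENNReal.ofReal (‖x - y‖ ^ (-μ)) :=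
      ((measurable_const.sub measurable_id).norm.pow_const _).ennreal_ofReal
    calc _ ≤ ∫⁻ y in (Metric.ball x R)ᶜ, ENNReal.ofReal (f y * ‖x - y‖ ^ (-μ)) :=
          lintegral_mono_set inter_subset_right
      _ = ∫⁻ y in (Metric.ball x R)ᶜ,
            ((fun y => ENNReal.ofReal (f y)) * fun y => ENNReal.ofReal (‖x - y‖ ^ (-μ))) y := by
          congr 1 with y
          rw [Pi.mul_apply, ENNReal.ofReal_mul (hf0 y)]
      _ ≤ (∫⁻ y in (Metric.ball x R)ᶜ, ENNReal.ofReal (f y) ^ (2 * (n : ℝ) / (2 * n - μ))) ^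
              (1 / (2 * (n : ℝ) / (2 * n - μ))) *
            (∫⁻ y in (Metric.ball x R)ᶜ, ENNReal.ofReal (‖x - y‖ ^ (-μ)) ^ (2 * (n : ℝ) / μ)) ^
              (1 / (2 * (n : ℝ) / μ)) :=
          ENNReal.lintegral_mul_le_Lp_mul_Lq _ hconj hmeas1.aemeasurable hmeas2.aemeasurable
      _ ≤ 1 * (C₂ * ENNReal.ofReal (R ^ (-n : ℝ))) ^ (1 / (2 * (n : ℝ) / μ)) := by
          gcongr ?_ * ?_ ^ _
          · refine ENNReal.rpow_le_one ?_ (by positivity)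
            refine (setLIntegral_le_lintegral _ _).trans (le_trans (le_of_eq ?_) hf1)
            congr 1 with y
            rw [ENNReal.ofReal_rpow_of_nonneg (hf0 y) (by positivity)]
          · refine le_trans (le_of_eq ?_) (hC₂ R hR)
            rw [← lintegral_indicator measurableSet_ball.compl,
              ← lintegral_indicator measurableSet_ball.compl,
              ← lintegral_sub_left_eq_self ((Metric.ball (0 : Eucl n) R)ᶜ.indicator _) x]
            congr 1 with y
            simp only [indicator, mem_compl_iff, Metric.mem_ball, dist_eq_norm, norm_sub_rev y x,
              sub_zero]
            rw [ENNReal.ofReal_rpow_of_nonneg (by positivity) (by positivity),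
              ← Real.rpow_mul (by positivity)]
            congr 4
            field_simp
      _ = _ := by
          have he : 1 / (2 * (n : ℝ) / μ) = μ / (2 * n) := by field_simp
          rw [one_mul, he, ENNReal.mul_rpow_of_nonneg _ _ (by positivity),
            ← ENNReal.coe_rpow_of_nonneg _ (by positivity),
            ENNReal.ofReal_rpow_of_nonneg (by positivity) (by positivity), hRdef,
            ← Real.rpow_mul ha.le, ← Real.rpow_mul ha.le]
          congr 3
          field_simp
  calc _ = _ := (lintegral_inter_add_sdiff _ _ measurableSet_ball (B := Metric.ball x R)).symm
    _ ≤ _ := add_le_add hnear hfar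
    _ = _ := by rw [ENNReal.coe_add, add_mul]

/-- The **Hardy–Littlewood–Sobolev inequality** for two equal functions, in normalised form. -/
theorem exists_hardyLittlewoodSobolev {n : ℕ} (hn : 0 < n) {μ : ℝ} (hμ : 0 < μ) (hμn : μ < n) :
    ∃ C : ℝ≥0, ∀ f : Eucl n → ℝ, Measurable f → (∀ x, 0 ≤ f x) →
      ∫⁻ x, ENNReal.ofReal (f x ^ (2 * n / (2 * n - μ))) ≤ 1 →
      ∫⁻ x, ∫⁻ y, ENNReal.ofReal (f x * f y / ‖x - y‖ ^ μ) ≤ C := by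
  obtain ⟨C, hC⟩ := exists_lintegral_truncated_potential_le hn hμ hμn
  have hn' : (0 : ℝ) < n := by exact_mod_cast hn
  have hd : 0 < 2 * (n : ℝ) - μ := by linarith
  refine ⟨C + C, fun f hf hf0 hf1 => ?_⟩
  set k : Eucl n → Eucl n → ℝ≥0∞ := fun x y => ENNReal.ofReal (f x * f y / ‖x - y‖ ^ μ) with hk
  have hksymm : ∀ x y, k x y = k y x := fun x y => by
    simp only [hk, norm_sub_rev x y, mul_comm (f x)]
  have hkm : Measurable (Function.uncurry k) := by
    refine (((hf.comp measurable_fst).mul (hf.comp measurable_snd)).div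
      ((measurable_fst.sub measurable_snd).norm.pow_const _)).ennreal_ofReal
  have hset : MeasurableSet {z : Eucl n × Eucl n | f z.2 ≤ f z.1} :=
    measurableSet_le (hf.comp measurable_snd) (hf.comp measurable_fst)
  -- By symmetry it is enough to integrate over `f y ≤ f x`. There the truncated potential at height
  -- `f x` applies, and `f x · (f x)^(μ/(2n-μ)) = (f x)^(2n/(2n-μ))` is integrable by normalisation.
  set k' : Eucl n → Eucl n → ℝ≥0∞ := fun x y => {y | f y ≤ f x}.indicator (k x) y with hk'
  have hkm' : Measurable (Function.uncurry k') := by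
    have : Function.uncurry k' = {z : Eucl n × Eucl n | f z.2 ≤ f z.1}.indicator
        (Function.uncurry k) := by
      ext z; simp [hk', indicator, Function.uncurry]
    rw [this]; exact hkm.indicator hset
  have hle : ∀ x y, k x y ≤ k' x y + k' y x := by
    intro x y
    rcases le_total (f y) (f x) with h | h
    · exact le_add_right (by simp [hk', indicator, h])
    · exact le_add_left (by simp [hk', indicator, h, hksymm x y])
  have hhalf : ∫⁻ x, ∫⁻ y, k' x y ≤ C := by
    calc _ ≤ ∫⁻ x, C * ENNReal.ofReal (f x ^ (2 * n / (2 * n - μ))) := by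
          refine lintegral_mono fun x => ?_
          rcases (hf0 x).eq_or_lt with h0 | h0
          · have : ∀ y, k' x y = 0 := fun y => by
              simp [hk', hk, indicator, ← h0]
            simp [this]
          · have hms : MeasurableSet {y | f y ≤ f x} := measurableSet_le hf measurable_const
            calc _ = ∫⁻ y in {y | f y ≤ f x},
                    ENNReal.ofReal (f x) * ENNReal.ofReal (f y * ‖x - y‖ ^ (-μ)) := by
                  rw [lintegral_indicator hms]
                  congr 1 with y
                  rw [← ENNReal.ofReal_mul h0.le, Real.rpow_neg (norm_nonneg _), ← mul_assoc,
                    ← div_eq_mul_inv]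
              _ = ENNReal.ofReal (f x) *
                    ∫⁻ y in {y | f y ≤ f x}, ENNReal.ofReal (f y * ‖x - y‖ ^ (-μ)) :=
                  lintegral_const_mul' _ _ ENNReal.ofReal_ne_top
              _ ≤ ENNReal.ofReal (f x) * (C * ENNReal.ofReal (f x ^ (μ / (2 * n - μ)))) := by
                  gcongr; exact hC f hf hf0 hf1 (f x) x h0
              _ = _ := by
                  rw [mul_left_comm, ← ENNReal.ofReal_mul h0.le]
                  congr 2
                  rw [← Real.rpow_one_add' h0.le (by positivity)]
                  congr 1; field_simp; ring
      _ = C * ∫⁻ x, ENNReal.ofReal (f x ^ (2 * n / (2 * n - μ))) :=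
          lintegral_const_mul' _ _ ENNReal.coe_ne_top
      _ ≤ C * 1 := by gcongr
      _ = C := mul_one _
  calc ∫⁻ x, ∫⁻ y, k x y ≤ ∫⁻ x, ∫⁻ y, (k' x y + k' y x) :=
        lintegral_mono fun x => lintegral_mono fun y => hle x y
    _ = (∫⁻ x, ∫⁻ y, k' x y) + ∫⁻ x, ∫⁻ y, k' y x := by
        rw [← lintegral_add_left (Measurable.lintegral_prod_right hkm')]
        congr 1 with x
        exact lintegral_add_left (hkm'.comp measurable_prodMk_left) _
    _ = (∫⁻ x, ∫⁻ y, k' x y) + ∫⁻ x, ∫⁻ y, k' x y := by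
        rw [lintegral_lintegral_swap (f := fun x y => k' y x)
          (hkm'.comp measurable_swap).aemeasurable]
    _ ≤ C + C := add_le_add hhalf hhalf
    _ = _ := by push_cast; rfl

/-! ### Weak gradients and test functions -/

theorem isWeakGrad_weakGrad {n : ℕ} {Ω : Set (Eucl n)} {u : Eucl n → ℝ}
    (h : ∃ g, IsWeakGrad Ω u g) : IsWeakGrad Ω u (weakGrad Ω u) := by
  rw [weakGrad, dif_pos h]
  exact h.choose_spec

theorem norm_gradient {n : ℕ} (ψ : Eucl n → ℝ) (x : Eucl n) :
    ‖gradient ψ x‖ = ‖fderiv ℝ ψ x‖ := by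
  rw [gradient, LinearIsometryEquiv.norm_map]

theorem continuous_gradient {n : ℕ} {ψ : Eucl n → ℝ} (h : ContDiff ℝ 1 ψ) :
    Continuous (gradient ψ) :=
  (LinearIsometryEquiv.continuous _).comp (h.continuous_fderiv one_ne_zero)

theorem support_gradient_subset {n : ℕ} (ψ : Eucl n → ℝ) :
    Function.support (gradient ψ) ⊆ tsupport ψ := by
  refine Subset.trans (fun x hx => ?_) (support_fderiv_subset ℝ)
  rw [Function.mem_support, ← norm_ne_zero_iff] at hx ⊢
  rwa [← norm_gradient]

theorem hasCompactSupport_gradient {n : ℕ} {ψ : Eucl n → ℝ} (h : HasCompactSupport ψ) :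
    HasCompactSupport (gradient ψ) :=
  HasCompactSupport.of_support_subset_isCompact h (support_gradient_subset ψ)

theorem IsTestFun.contDiff_one {n : ℕ} {Ω : Set (Eucl n)} {ψ : Eucl n → ℝ}
    (h : IsTestFun Ω ψ) : ContDiff ℝ 1 ψ :=
  h.smooth.of_le (by exact_mod_cast le_top)

theorem IsTestFun.eLpNorm_restrict {n : ℕ} {Ω : Set (Eucl n)} {ψ : Eucl n → ℝ}
    (h : IsTestFun Ω ψ) (p : ℝ≥0∞) :
    eLpNorm ψ p (volume.restrict Ω) = eLpNorm ψ p volume :=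
  eLpNorm_restrict_eq_of_support_subset ((subset_tsupport _).trans h.support_subset)

theorem IsTestFun.eLpNorm_gradient_restrict {n : ℕ} {Ω : Set (Eucl n)} {ψ : Eucl n → ℝ}
    (h : IsTestFun Ω ψ) (p : ℝ≥0∞) :
    eLpNorm (gradient ψ) p (volume.restrict Ω) = eLpNorm (gradient ψ) p volume :=
  eLpNorm_restrict_eq_of_support_subset ((support_gradient_subset _).trans h.support_subset)

theorem IsWeakGrad.integrable_smul {n : ℕ} {Ω : Set (Eucl n)} {u : Eucl n → ℝ}
    {g : Eucl n → Eucl n} (h : IsWeakGrad Ω u g) {ψ : Eucl n → ℝ} (hψ : IsTestFun Ω ψ) :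
    Integrable (fun x => ψ x • g x) (volume.restrict Ω) :=
  (h.memLp.locallyIntegrable one_le_two).integrable_smul_left_of_hasCompactSupport
    hψ.smooth.continuous hψ.compactSupport

/-- The fundamental lemma of the calculus of variations. Since `weakGrad` is an arbitrary choice,
this is what allows it to be computed. -/
theorem IsWeakGrad.ae_eq {n : ℕ} {Ω : Set (Eucl n)} (hΩ : IsOpen Ω) {u : Eucl n → ℝ}
    {g g' : Eucl n → Eucl n} (h : IsWeakGrad Ω u g) (h' : IsWeakGrad Ω u g') :
    g =ᵐ[volume.restrict Ω] g' := by
  have hloc : LocallyIntegrableOn (fun x => g x - g' x) Ω volume :=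
    locallyIntegrableOn_of_locallyIntegrable_restrict
      ((h.memLp.sub h'.memLp).locallyIntegrable one_le_two)
  have key := hΩ.ae_eq_zero_of_integral_contDiff_smul_eq_zero hloc fun ψ h1 h2 h3 => by
    have hψ : IsTestFun Ω ψ := ⟨h1, h2, h3⟩
    rw [← setIntegral_eq_integral_of_forall_compl_eq_zero (s := Ω)]
    · simp_rw [smul_sub]
      rw [integral_sub (h.integrable_smul hψ) (h'.integrable_smul hψ), sub_eq_zero,
        ← neg_inj, ← h.integral_eq ψ hψ, ← h'.integral_eq ψ hψ]
    · intro x hx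
      rw [image_eq_zero_of_notMem_tsupport (fun h => hx (h3 h)), zero_smul]
  rw [Filter.EventuallyEq, ae_restrict_iff' hΩ.measurableSet]
  filter_upwards [key] with x hx hxΩ using sub_eq_zero.1 (hx hxΩ)

theorem IsWeakGrad.const_mul {n : ℕ} {Ω : Set (Eucl n)} {u : Eucl n → ℝ}
    {g : Eucl n → Eucl n} (h : IsWeakGrad Ω u g) (t : ℝ) :
    IsWeakGrad Ω (fun x => t * u x) (fun x => t • g x) where
  memLp := h.memLp.const_smul t
  integral_eq ψ hψ := by
    have h1 : ∀ x, (t * u x) • gradient ψ x = t • (u x • gradient ψ x) := fun x => mul_smul _ _ _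
    have h2 : ∀ x, ψ x • t • g x = t • (ψ x • g x) := fun x => smul_comm _ _ _
    simp_rw [h1, h2]
    rw [integral_smul, integral_smul, h.integral_eq ψ hψ, smul_neg]

theorem IsTestFun.isWeakGrad {n : ℕ} {Ω : Set (Eucl n)} {u : Eucl n → ℝ}
    (hu : IsTestFun Ω u) : IsWeakGrad Ω u (gradient u) where
  memLp := ((continuous_gradient hu.contDiff_one).memLp_of_hasCompactSupport
    (hasCompactSupport_gradient hu.compactSupport)).restrict _
  integral_eq ψ hψ := by
    have hcu := hu.smooth.continuous
    have hcψ := hψ.smooth.continuous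
    have hgu := continuous_gradient hu.contDiff_one
    have hgψ := continuous_gradient hψ.contDiff_one
    have i1 : Integrable (fun x => u x • gradient ψ x) :=
      (hcu.smul hgψ).integrable_of_hasCompactSupport hu.compactSupport.smul_right
    have i2 : Integrable (fun x => ψ x • gradient u x) :=
      (hcψ.smul hgu).integrable_of_hasCompactSupport hψ.compactSupport.smul_right
    rw [setIntegral_eq_integral_of_forall_compl_eq_zero,
      setIntegral_eq_integral_of_forall_compl_eq_zero]
    -- Pairing with a fixed vector `v` reduces the vector identity to scalar integration by parts in
    -- the direction `v`.
    · refine ext_inner_right ℝ fun v => ?_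
      rw [inner_neg_left, real_inner_comm, real_inner_comm v, ← integral_inner i1,
        ← integral_inner i2]
      have e1 : ∀ x, inner ℝ v (u x • gradient ψ x) = u x * fderiv ℝ ψ x v := fun x => by
        rw [inner_smul_right, real_inner_comm, inner_gradient_left]
      have e2 : ∀ x, inner ℝ v (ψ x • gradient u x) = fderiv ℝ u x v * ψ x := fun x => by
        rw [inner_smul_right, real_inner_comm, inner_gradient_left, mul_comm]
      simp_rw [e1, e2]
      refine integral_mul_fderiv_eq_neg_fderiv_mul_of_integrable ?_ ?_ ?_
        (fun x _ => (hu.contDiff_one.differentiable one_ne_zero).differentiableAt)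
        (fun x _ => (hψ.contDiff_one.differentiable one_ne_zero).differentiableAt)
      · simp_rw [← e2]; exact i2.const_inner v
      · simp_rw [← e1]; exact i1.const_inner v
      · exact (hcu.mul hcψ).integrable_of_hasCompactSupport hu.compactSupport.mul_right
    · intro x hx
      rw [image_eq_zero_of_notMem_tsupport (fun h => hx (hψ.support_subset h)), zero_smul]
    · intro x hx
      rw [image_eq_zero_of_notMem_tsupport (fun h => hx (hu.support_subset h)), zero_smul]

theorem IsTestFun.memH1 {n : ℕ} {Ω : Set (Eucl n)} {u : Eucl n → ℝ} (hu : IsTestFun Ω u) :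
    MemH1 Ω u :=
  ⟨(hu.smooth.continuous.memLp_of_hasCompactSupport hu.compactSupport).restrict _, _,
    hu.isWeakGrad⟩

theorem IsTestFun.memH10 {n : ℕ} {Ω : Set (Eucl n)} (hΩ : IsOpen Ω) {u : Eucl n → ℝ}
    (hu : IsTestFun Ω u) : MemH10 Ω u := by
  refine ⟨hu.memH1, fun ε hε => ⟨u, hu, ?_, ?_⟩⟩
  · simpa using hε
  · have : (fun x => weakGrad Ω u x - gradient u x) =ᵐ[volume.restrict Ω] 0 := by
      filter_upwards [(isWeakGrad_weakGrad hu.memH1.2).ae_eq hΩ hu.isWeakGrad] with x hx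
      simp [hx]
    rw [eLpNorm_congr_ae this]
    simpa using hε

theorem MemH1.const_mul {n : ℕ} {Ω : Set (Eucl n)} {u : Eucl n → ℝ} (hu : MemH1 Ω u) (t : ℝ) :
    MemH1 Ω (fun x => t * u x) :=
  ⟨hu.1.const_mul t, _, (isWeakGrad_weakGrad hu.2).const_mul t⟩

theorem dirichlet_const_mul {n : ℕ} {Ω : Set (Eucl n)} (hΩ : IsOpen Ω) {u : Eucl n → ℝ}
    (hu : MemH1 Ω u) (t : ℝ) : dirichlet Ω (fun x => t * u x) = t ^ 2 * dirichlet Ω u := by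
  have h := (isWeakGrad_weakGrad (hu.const_mul t).2).ae_eq hΩ ((isWeakGrad_weakGrad hu.2).const_mul t)
  rw [dirichlet, dirichlet, ← integral_const_mul]
  refine integral_congr_ae ?_
  filter_upwards [h] with x hx
  rw [hx, norm_smul, mul_pow, Real.norm_eq_abs, sq_abs]

theorem dirichlet_nonneg {n : ℕ} (Ω : Set (Eucl n)) (u : Eucl n → ℝ) : 0 ≤ dirichlet Ω u :=
  integral_nonneg fun _ => by positivity

theorem MemH1.eLpNorm_weakGrad {n : ℕ} {Ω : Set (Eucl n)} {u : Eucl n → ℝ} (hu : MemH1 Ω u) :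
    eLpNorm (weakGrad Ω u) 2 (volume.restrict Ω) = ENNReal.ofReal (dirichlet Ω u ^ (1 / 2 : ℝ)) := by
  rw [(isWeakGrad_weakGrad hu.2).memLp.eLpNorm_eq_integral_rpow_norm two_ne_zero ENNReal.ofNat_ne_top]
  simp [dirichlet]

/-! ### The Sobolev inequality on `H¹₀(Ω)` -/

/-- The Sobolev exponent `2n/(n-2)`. -/
def sobolevExp (n : ℕ) : ℝ := 2 * n / (n - 2)

theorem sobolevExp_pos {n : ℕ} (hn : 2 < n) : 0 < sobolevExp n := by
  have : (2 : ℝ) < n := by exact_mod_cast hn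
  exact div_pos (by linarith) (by linarith)

theorem exists_sobolev_of_contDiff {n : ℕ} (hn : 2 < n) :
    ∃ K : ℝ≥0, ∀ ψ : Eucl n → ℝ, ContDiff ℝ 1 ψ → HasCompactSupport ψ →
      eLpNorm ψ (ENNReal.ofReal (sobolevExp n)) volume ≤ K * eLpNorm (gradient ψ) 2 volume := by
  have hn' : (2 : ℝ) < n := by exact_mod_cast hn
  refine ⟨SNormLESNormFDerivOfEqConst ℝ (volume : Measure (Eucl n)) 2, fun ψ h1 h2 => ?_⟩
  have := eLpNorm_le_eLpNorm_fderiv_of_eq (volume : Measure (Eucl n)) h1 h2 (p := 2)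
    (p' := (sobolevExp n).toNNReal) one_le_two (by simp; omega) (by
      rw [Real.coe_toNNReal _ (sobolevExp_pos hn).le, sobolevExp]
      have : (n : ℝ) - 2 ≠ 0 := by linarith
      simp
      field_simp)
  refine this.trans (le_of_eq ?_)
  congr 1
  exact eLpNorm_congr_norm_ae (Eventually.of_forall fun x => (norm_gradient ψ x).symm)

/-- Fatou's lemma: this carries Sobolev bounds from smooth approximations to their almost everywhere
limit, without convergence in the critical norm. -/
theorem eLpNorm_le_of_ae_tendsto {α : Type*} [MeasurableSpace α] {ν : Measure α} {p : ℝ≥0∞}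
    {f : ℕ → α → ℝ} {u : α → ℝ} {b : ℕ → ℝ≥0∞} {B : ℝ≥0∞}
    (hf : ∀ k, AEStronglyMeasurable (f k) ν)
    (hlim : ∀ᵐ x ∂ν, Tendsto (fun k => f k x) atTop (𝓝 (u x)))
    (hb : ∀ k, eLpNorm (f k) p ν ≤ b k) (hB : Tendsto b atTop (𝓝 B)) : eLpNorm u p ν ≤ B := by
  refine (Lp.eLpNorm_lim_le_liminf_eLpNorm hf u hlim).trans ?_
  rw [← hB.liminf_eq]
  exact liminf_le_liminf (Eventually.of_forall hb)

/-- Test functions of `Ω` have the same norms on `Ω` and on `ℝⁿ`, so the whole-space constant serves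
every `Ω`; an almost everywhere convergent subsequence of approximants then gives the bound for `u`.
-/
theorem exists_sobolev_memH10 {n : ℕ} (hn : 2 < n) :
    ∃ K : ℝ≥0, ∀ (Ω : Set (Eucl n)) (u : Eucl n → ℝ), MemH10 Ω u →
      eLpNorm u (ENNReal.ofReal (sobolevExp n)) (volume.restrict Ω) ≤
        K * eLpNorm (weakGrad Ω u) 2 (volume.restrict Ω) := by
  obtain ⟨K, hK⟩ := exists_sobolev_of_contDiff hn
  refine ⟨K, fun Ω u hu => ?_⟩
  have hε : ∀ k : ℕ, (0 : ℝ≥0∞) < (k + 1 : ℝ≥0∞)⁻¹ := fun k => by simp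
  have hε0 : Tendsto (fun k : ℕ => (k + 1 : ℝ≥0∞)⁻¹) atTop (𝓝 0) := by
    have := (tendsto_add_atTop_iff_nat 1).2 ENNReal.tendsto_inv_nat_nhds_zero
    simpa using this
  choose ψ hψ h1 h2 using fun k => hu.2 _ (hε k)
  have hmeas : ∀ k, AEStronglyMeasurable (ψ k) (volume.restrict Ω) :=
    fun k => (hψ k).smooth.continuous.aestronglyMeasurable
  have hg := (isWeakGrad_weakGrad hu.1.2).memLp
  obtain ⟨ns, hns, hae⟩ := (tendstoInMeasure_of_tendsto_eLpNorm (p := 2) two_ne_zero hmeas hu.1.1.1 (by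
    refine tendsto_of_tendsto_of_tendsto_of_le_of_le tendsto_const_nhds hε0
      (fun k => bot_le) fun k => ?_
    rw [eLpNorm_sub_comm]
    exact (h1 k).le)).exists_seq_tendsto_ae
  refine eLpNorm_le_of_ae_tendsto (b := fun k => K * (eLpNorm (weakGrad Ω u) 2 (volume.restrict Ω) +
    (ns k + 1 : ℝ≥0∞)⁻¹)) (fun k => hmeas (ns k)) hae (fun k => ?_) ?_
  · rw [(hψ _).eLpNorm_restrict]
    refine (hK _ (hψ _).contDiff_one (hψ _).compactSupport).trans ?_
    gcongr
    rw [← (hψ _).eLpNorm_gradient_restrict]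
    have hgψ : AEStronglyMeasurable (gradient (ψ (ns k))) (volume.restrict Ω) :=
      (continuous_gradient (hψ _).contDiff_one).aestronglyMeasurable
    have e : gradient (ψ (ns k)) = weakGrad Ω u - (fun x => weakGrad Ω u x - gradient (ψ (ns k)) x) := by
      ext1 x; simp
    rw [e]
    refine (eLpNorm_sub_le hg.1 (hg.1.sub hgψ) one_le_two).trans ?_
    gcongr
    exact (h2 (ns k)).le
  · have := (tendsto_const_nhds (x := eLpNorm (weakGrad Ω u) 2 (volume.restrict Ω))).add
      (hε0.comp hns.tendsto_atTop)
    rw [add_zero] at this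
    exact ENNReal.Tendsto.const_mul this (Or.inr ENNReal.coe_ne_top)

/-! ### The Sobolev inequality on `H¹(ℝⁿ)` by mollification and cutoff -/

/-- Averaging against a probability density does not increase the `L²` norm. -/
theorem lintegral_sq_average_le {n : ℕ} {ρ : Eucl n → ℝ≥0∞} (hρ : Measurable ρ)
    (hρ1 : ∫⁻ t, ρ t = 1) {F : Eucl n → ℝ≥0∞} (hF : AEMeasurable F) :
    ∫⁻ x, (∫⁻ y, ρ (x - y) * F y) ^ (2 : ℝ) ≤ ∫⁻ y, F y ^ (2 : ℝ) := by
  wlog hFm : Measurable F generalizing F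
  · have h := this hF.measurable_mk.aemeasurable hF.measurable_mk
    have e1 : ∀ x, ∫⁻ y, ρ (x - y) * F y = ∫⁻ y, ρ (x - y) * hF.mk F y := fun x =>
      lintegral_congr_ae (by filter_upwards [hF.ae_eq_mk] with y hy; rw [← hy])
    have e2 : ∫⁻ y, F y ^ (2 : ℝ) = ∫⁻ y, hF.mk F y ^ (2 : ℝ) :=
      lintegral_congr_ae (by filter_upwards [hF.ae_eq_mk] with y hy; rw [← hy])
    simp_rw [e1, e2]
    exact h
  have hone : ∀ x, ∫⁻ y, ρ (x - y) = 1 := fun x => by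
    rw [lintegral_sub_left_eq_self ρ x, hρ1]
  have hpt : ∀ x, (∫⁻ y, ρ (x - y) * F y) ^ (2 : ℝ) ≤ ∫⁻ y, ρ (x - y) * F y ^ (2 : ℝ) := by
    intro x
    have hρx : Measurable fun y => ρ (x - y) := hρ.comp (measurable_const.sub measurable_id)
    -- Cauchy–Schwarz after splitting `ρ = ρ^(1/2) · ρ^(1/2)`; the first factor integrates to `1`.
    have hh := ENNReal.lintegral_mul_le_Lp_mul_Lq (volume : Measure (Eucl n))
      (p := 2) (q := 2) Real.HolderConjugate.two_two
      (f := fun y => ρ (x - y) ^ (1 / 2 : ℝ)) (g := fun y => ρ (x - y) ^ (1 / 2 : ℝ) * F y)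
      (hρx.pow_const _).aemeasurable ((hρx.pow_const _).mul hFm).aemeasurable
    have e1 : ∀ y, ((fun y => ρ (x - y) ^ (1 / 2 : ℝ)) * fun y => ρ (x - y) ^ (1 / 2 : ℝ) * F y) y =
        ρ (x - y) * F y := fun y => by
      rw [Pi.mul_apply, ← mul_assoc, ← ENNReal.rpow_add_of_nonneg _ _ (by norm_num) (by norm_num)]
      norm_num
    have e2 : ∀ y, (ρ (x - y) ^ (1 / 2 : ℝ)) ^ (2 : ℝ) = ρ (x - y) := fun y => by
      rw [← ENNReal.rpow_mul]; norm_num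
    have e3 : ∀ y, (ρ (x - y) ^ (1 / 2 : ℝ) * F y) ^ (2 : ℝ) = ρ (x - y) * F y ^ (2 : ℝ) :=
      fun y => by rw [ENNReal.mul_rpow_of_nonneg _ _ (by norm_num), e2]
    simp_rw [e1, e2, e3, hone, ENNReal.one_rpow, one_mul] at hh
    calc _ ≤ ((∫⁻ y, ρ (x - y) * F y ^ (2 : ℝ)) ^ (1 / 2 : ℝ)) ^ (2 : ℝ) := by gcongr
      _ = _ := by rw [← ENNReal.rpow_mul]; norm_num
  refine (lintegral_mono hpt).trans ?_
  rw [lintegral_lintegral_swap]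
  · refine le_of_eq (lintegral_congr fun y => ?_)
    rw [lintegral_mul_const (f := fun x => ρ (x - y)) _
        (hρ.comp (measurable_id.sub measurable_const)),
      lintegral_sub_right_eq_self ρ y, hρ1, one_mul]
  · exact ((hρ.comp (measurable_fst.sub measurable_snd)).mul
      ((hFm.comp measurable_snd).pow_const _)).aemeasurable

theorem lintegral_ofReal_normed {n : ℕ} (φ : ContDiffBump (0 : Eucl n)) :
    ∫⁻ t, ENNReal.ofReal (φ.normed volume t) = 1 := by
  rw [← ofReal_integral_eq_lintegral_ofReal φ.integrable_normed
    (Eventually.of_forall φ.nonneg_normed), φ.integral_normed, ENNReal.ofReal_one]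

theorem eLpNorm_integral_normed_smul_le {n : ℕ} {V : Type*} [NormedAddCommGroup V]
    [NormedSpace ℝ V] (φ : ContDiffBump (0 : Eucl n)) {h : Eucl n → V}
    (hh : AEStronglyMeasurable h volume) :
    eLpNorm (fun x => ∫ y, φ.normed volume (x - y) • h y) 2 volume ≤ eLpNorm h 2 volume := by
  rw [eLpNorm_eq_lintegral_rpow_enorm_toReal two_ne_zero ENNReal.ofNat_ne_top,
    eLpNorm_eq_lintegral_rpow_enorm_toReal two_ne_zero ENNReal.ofNat_ne_top, ENNReal.toReal_ofNat]
  gcongr ?_ ^ _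
  refine le_trans (lintegral_mono fun x => ?_) (lintegral_sq_average_le
    (ρ := fun t => ENNReal.ofReal (φ.normed volume t))
    φ.continuous_normed.measurable.ennreal_ofReal (lintegral_ofReal_normed φ) hh.enorm)
  gcongr
  refine (enorm_integral_le_lintegral_enorm _).trans (le_of_eq (lintegral_congr fun y => ?_))
  rw [enorm_smul, Real.enorm_of_nonneg (φ.nonneg_normed _)]

/-- For fixed `x` the kernel `y ↦ φ(x - y)` is itself a test function; the sign from the chain rule
cancels the one in the definition of the weak gradient. -/
theorem gradient_mollify {n : ℕ} (φ : ContDiffBump (0 : Eucl n)) {u : Eucl n → ℝ}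
    {g : Eucl n → Eucl n} (hu : LocallyIntegrable u volume) (hg : IsWeakGrad univ u g)
    (x : Eucl n) :
    gradient (φ.normed volume ⋆[ContinuousLinearMap.lsmul ℝ ℝ, volume] u) x =
      ∫ y, φ.normed volume (x - y) • g y := by
  have hρ : ContDiff ℝ ∞ (φ.normed volume) := φ.contDiff_normed
  have hρ1 : ContDiff ℝ 1 (φ.normed volume) := φ.contDiff_normed
  have hψ : IsTestFun univ (fun y => φ.normed volume (x - y)) := by
    refine ⟨hρ.comp (contDiff_const.sub contDiff_id), ?_, subset_univ _⟩
    exact φ.hasCompactSupport_normed.comp_homeomorph (Homeomorph.subLeft x)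
  have hgrad : ∀ y, gradient (fun y => φ.normed volume (x - y)) y =
      -(gradient (φ.normed volume) (x - y)) := by
    intro y
    have h1 : HasFDerivAt (φ.normed volume) (fderiv ℝ (φ.normed volume) (x - y)) (x - y) :=
      (hρ1.differentiable one_ne_zero _).hasFDerivAt
    have h2 := h1.comp y ((hasFDerivAt_const x y).sub (hasFDerivAt_id y))
    have h3 : fderiv ℝ (fun y => φ.normed volume (x - y)) y =
        -fderiv ℝ (φ.normed volume) (x - y) := by
      refine h2.fderiv.trans ?_
      ext v
      simp
    rw [gradient, gradient, h3, map_neg]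
  have hint := hg.integral_eq _ hψ
  simp only [hgrad, smul_neg, Measure.restrict_univ, integral_neg, neg_inj] at hint
  rw [← hint, gradient,
    (φ.hasCompactSupport_normed.hasFDerivAt_convolution_left
      (ContinuousLinearMap.lsmul ℝ ℝ) hρ1 hu x).fderiv, convolution_eq_swap]
  rw [← LinearIsometryEquiv.coe_toContinuousLinearEquiv, ← ContinuousLinearEquiv.integral_comp_comm]
  refine integral_congr_ae (Eventually.of_forall fun y => ?_)
  have e : (ContinuousLinearMap.precompL (Eucl n) (ContinuousLinearMap.lsmul ℝ ℝ))
      (fderiv ℝ (φ.normed volume) (x - y)) (u y) = u y • fderiv ℝ (φ.normed volume) (x - y) := by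
    ext v
    simp [mul_comm]
  simp only [e, map_smul]
  rfl

/-- The approximants are mollifications times cutoffs at scale `k + 1`. Differentiating the cutoff
costs at most `M (k+1)⁻¹ ‖u‖₂`, which vanishes in the limit because `u ∈ L²`. -/
theorem exists_sobolev_memH1_univ {n : ℕ} (hn : 2 < n) :
    ∃ K : ℝ≥0, ∀ u : Eucl n → ℝ, MemH1 univ u →
      eLpNorm u (ENNReal.ofReal (sobolevExp n)) volume ≤
        K * eLpNorm (weakGrad univ u) 2 volume := by
  obtain ⟨K, hK⟩ := exists_sobolev_of_contDiff hn
  refine ⟨K, fun u hu => ?_⟩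
  have hu2 : MemLp u 2 volume := by simpa using hu.1
  have hwg := isWeakGrad_weakGrad hu.2
  have hg2 : MemLp (weakGrad univ u) 2 volume := by simpa using hwg.memLp
  have hloc : LocallyIntegrable u volume := hu2.locallyIntegrable one_le_two
  let φ : ℕ → ContDiffBump (0 : Eucl n) := fun k =>
    ⟨1 / ((k : ℝ) + 1), 2 / ((k : ℝ) + 1), by positivity, by gcongr; norm_num⟩
  let χ : ContDiffBump (0 : Eucl n) := ⟨1, 2, one_pos, one_lt_two⟩
  have hχ1 : ContDiff ℝ 1 χ := χ.contDiff
  obtain ⟨M, hM⟩ := (hχ1.continuous_fderiv one_ne_zero).bounded_above_of_compact_support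
    (χ.hasCompactSupport.fderiv ℝ)
  have hM0 : 0 ≤ M := (norm_nonneg _).trans (hM 0)
  let c : ℕ → Eucl n → ℝ := fun k x => χ (((k : ℝ) + 1)⁻¹ • x)
  let w : ℕ → Eucl n → ℝ := fun k =>
    (φ k).normed volume ⋆[ContinuousLinearMap.lsmul ℝ ℝ, volume] u
  have hw : ∀ k, ContDiff ℝ 1 (w k) := fun k =>
    (φ k).hasCompactSupport_normed.contDiff_convolution_left (n := 1) _ (φ k).contDiff_normed hloc
  have hc : ∀ k, ContDiff ℝ 1 (c k) := fun k => hχ1.comp (contDiff_const_smul _)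
  have hcc : ∀ k, HasCompactSupport (c k) := fun k =>
    χ.hasCompactSupport.comp_smul (by positivity)
  have hcgrad : ∀ k x, ‖fderiv ℝ (c k) x‖ ≤ M * ((k : ℝ) + 1)⁻¹ := by
    intro k x
    have h1 : HasFDerivAt χ (fderiv ℝ χ (((k : ℝ) + 1)⁻¹ • x)) (((k : ℝ) + 1)⁻¹ • x) :=
      (hχ1.differentiable one_ne_zero _).hasFDerivAt
    have h2 : HasFDerivAt (c k) _ x := h1.comp x ((hasFDerivAt_id x).const_smul (((k : ℝ) + 1)⁻¹))
    rw [h2.fderiv]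
    refine (ContinuousLinearMap.opNorm_comp_le _ _).trans ?_
    refine mul_le_mul (hM _) ?_ (norm_nonneg _) hM0
    rw [norm_smul, Real.norm_of_nonneg (by positivity)]
    exact mul_le_of_le_one_right (by positivity) ContinuousLinearMap.norm_id_le
  have hwn : ∀ k, eLpNorm (w k) 2 volume ≤ eLpNorm u 2 volume := fun k => by
    refine le_trans (le_of_eq ?_) (eLpNorm_integral_normed_smul_le (φ k) hu2.1)
    congr 1
    ext x
    exact convolution_lsmul_swap
  have hwg2 : ∀ k, eLpNorm (gradient (w k)) 2 volume ≤ eLpNorm (weakGrad univ u) 2 volume :=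
    fun k => by
      refine le_trans (le_of_eq ?_) (eLpNorm_integral_normed_smul_le (φ k) hg2.1)
      congr 1
      ext1 x
      exact gradient_mollify (φ k) hloc hwg x
  have hbound : ∀ k, eLpNorm (gradient fun x => c k x * w k x) 2 volume ≤
      eLpNorm (weakGrad univ u) 2 volume +
        ENNReal.ofReal (M * ((k : ℝ) + 1)⁻¹) * eLpNorm u 2 volume := by
    intro k
    have hpt : ∀ x, ‖gradient (fun x => c k x * w k x) x‖ ≤
        ‖‖gradient (w k) x‖ + (M * ((k : ℝ) + 1)⁻¹) • ‖w k x‖‖ := by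
      intro x
      rw [norm_gradient, fderiv_fun_mul (hc k).differentiable_one.differentiableAt
        (hw k).differentiable_one.differentiableAt, norm_gradient]
      rw [Real.norm_of_nonneg (by positivity)]
      refine (norm_add_le _ _).trans (add_le_add ?_ ?_)
      · rw [norm_smul, Real.norm_of_nonneg χ.nonneg]
        exact mul_le_of_le_one_left (norm_nonneg _) χ.le_one
      · rw [norm_smul, mul_comm, smul_eq_mul]
        exact mul_le_mul_of_nonneg_right (hcgrad k x) (norm_nonneg _)
    refine (eLpNorm_mono hpt).trans ?_
    refine (eLpNorm_add_le (continuous_gradient (hw k)).norm.aestronglyMeasurable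
      ((hw k).continuous.norm.const_smul (M * ((k : ℝ) + 1)⁻¹)).aestronglyMeasurable
      one_le_two).trans ?_
    refine add_le_add ?_ ?_
    · rw [eLpNorm_norm]; exact hwg2 k
    · refine (eLpNorm_const_smul_le (c := M * ((k : ℝ) + 1)⁻¹) (f := fun x => ‖w k x‖)).trans ?_
      rw [Real.enorm_of_nonneg (by positivity), eLpNorm_norm]
      gcongr
      exact hwn k
  have hlimw : ∀ᵐ x, Tendsto (fun k => w k x) atTop (𝓝 (u x)) := by
    -- The outer and inner radii keep the ratio `2`, as Lebesgue differentiation for bump kernels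
    -- requires.
    refine ContDiffBump.ae_convolution_tendsto_right_of_locallyIntegrable (K := 2) ?_ ?_ hloc
    · exact tendsto_const_div_atTop_nhds_zero_nat (2 : ℝ) |>.comp (tendsto_add_atTop_nat 1) |>.congr
        fun k => by simp [φ]
    · refine Eventually.of_forall fun k => le_of_eq ?_
      simp only [φ]; ring
  have hinv : Tendsto (fun k : ℕ => ((k : ℝ) + 1)⁻¹) atTop (𝓝 0) := by
    simpa [one_div] using tendsto_one_div_add_atTop_nhds_zero_nat (𝕜 := ℝ)
  refine eLpNorm_le_of_ae_tendsto (f := fun k x => c k x * w k x)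
    (b := fun k => K * (eLpNorm (weakGrad univ u) 2 volume +
      ENNReal.ofReal (M * ((k : ℝ) + 1)⁻¹) * eLpNorm u 2 volume))
    (fun k => ((hc k).continuous.mul (hw k).continuous).aestronglyMeasurable) ?_ (fun k => ?_) ?_
  · filter_upwards [hlimw] with x hx
    refine hx.congr' ?_
    have h0 : Tendsto (fun k : ℕ => ‖((k : ℝ) + 1)⁻¹ • x‖) atTop (𝓝 0) := by
      simpa using (hinv.smul_const x).norm
    filter_upwards [h0.eventually_lt_const one_pos] with k hk
    have : c k x = 1 := χ.one_of_mem_closedBall (by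
      rw [mem_closedBall_zero_iff]; exact hk.le)
    rw [this, one_mul]
  · refine (hK _ ((hc k).mul (hw k)) ((hcc k).mul_right)).trans ?_
    gcongr
    exact hbound k
  · have h1 : Tendsto (fun k : ℕ => ENNReal.ofReal (M * ((k : ℝ) + 1)⁻¹) * eLpNorm u 2 volume)
        atTop (𝓝 0) := by
      have := ENNReal.tendsto_ofReal (hinv.const_mul M)
      rw [mul_zero, ENNReal.ofReal_zero] at this
      simpa using ENNReal.Tendsto.mul_const this (Or.inr hu2.2.ne)
    have h2 := (tendsto_const_nhds (x := eLpNorm (weakGrad univ u) 2 volume)).add h1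
    rw [add_zero] at h2
    exact ENNReal.Tendsto.const_mul h2 (Or.inr ENNReal.coe_ne_top)

/-! ### The double integral: scaling, upper bound, nonvanishing -/

theorem one_lt_critExp {n : ℕ} (hn : 2 < n) {μ : ℝ} (hμn : μ < n) : 1 < critExp n μ := by
  have : (2 : ℝ) < n := by exact_mod_cast hn
  rw [critExp, lt_div_iff₀ (by linarith)]
  linarith

/-- This identity makes the problem critical: Hardy–Littlewood–Sobolev applied to `|u|^p` asks for
exactly the Sobolev norm of `u`. -/
theorem critExp_mul_eq_sobolevExp {n : ℕ} {μ : ℝ} (hn : 0 < n) (hμn : μ < n) :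
    critExp n μ * (2 * n / (2 * n - μ)) = sobolevExp n := by
  have h1 : (0 : ℝ) < n := by exact_mod_cast hn
  have : 2 * (n : ℝ) - μ ≠ 0 := by linarith
  rw [critExp, sobolevExp]
  field_simp

theorem choquard_const_mul {n : ℕ} (μ : ℝ) (Ω : Set (Eucl n)) (u : Eucl n → ℝ) {t : ℝ}
    (ht : 0 < t) : choquard μ Ω (fun x => t * u x) =
      ENNReal.ofReal (t ^ (2 * critExp n μ)) * choquard μ Ω u := by
  rw [choquard, choquard, ← lintegral_const_mul' _ _ ENNReal.ofReal_ne_top]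
  refine lintegral_congr fun x => ?_
  rw [← lintegral_const_mul' _ _ ENNReal.ofReal_ne_top]
  refine lintegral_congr fun y => ?_
  rw [← ENNReal.ofReal_mul (by positivity), abs_mul, abs_mul, abs_of_pos ht,
    Real.mul_rpow ht.le (abs_nonneg _), Real.mul_rpow ht.le (abs_nonneg _), two_mul,
    Real.rpow_add ht]
  congr 1
  ring

theorem choquard_congr_ae {n : ℕ} {μ : ℝ} {Ω : Set (Eucl n)} {u v : Eucl n → ℝ}
    (h : u =ᵐ[volume.restrict Ω] v) : choquard μ Ω u = choquard μ Ω v := by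
  refine lintegral_congr_ae ?_
  filter_upwards [h] with x hx
  refine lintegral_congr_ae ?_
  filter_upwards [h] with y hy
  rw [hx, hy]

theorem choquard_zero {n : ℕ} {μ : ℝ} {Ω : Set (Eucl n)} (hp : critExp n μ ≠ 0) :
    choquard μ Ω (fun _ => 0) = 0 := by
  simp [choquard, Real.zero_rpow hp]

theorem choquard_eq_univ {n : ℕ} {μ : ℝ} {Ω : Set (Eucl n)} (hΩ : MeasurableSet Ω)
    (hp : critExp n μ ≠ 0) (u : Eucl n → ℝ) :
    choquard μ Ω u = ∫⁻ x, ∫⁻ y, ENNReal.ofReal (|Ω.indicator u x| ^ critExp n μ *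
      |Ω.indicator u y| ^ critExp n μ / ‖x - y‖ ^ μ) := by
  rw [choquard, ← lintegral_indicator hΩ]
  refine lintegral_congr fun x => ?_
  by_cases hx : x ∈ Ω
  · rw [indicator_of_mem hx, ← lintegral_indicator hΩ]
    refine lintegral_congr fun y => ?_
    by_cases hy : y ∈ Ω
    · simp [hx, hy]
    · simp [hy, Real.zero_rpow hp]
  · simp [hx, Real.zero_rpow hp]

/-- The double integral is controlled by the critical Lebesgue norm. -/
theorem exists_choquard_le {n : ℕ} (hn : 2 < n) {μ : ℝ} (hμ : 0 < μ) (hμn : μ < n) :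
    ∃ C : ℝ≥0, ∀ (Ω : Set (Eucl n)) (u : Eucl n → ℝ) (M : ℝ), MeasurableSet Ω →
      AEStronglyMeasurable u (volume.restrict Ω) → 0 ≤ M →
      eLpNorm u (ENNReal.ofReal (sobolevExp n)) (volume.restrict Ω) ≤ ENNReal.ofReal M →
      choquard μ Ω u ≤ C * ENNReal.ofReal (M ^ (2 * critExp n μ)) := by
  obtain ⟨C, hC⟩ := exists_hardyLittlewoodSobolev (by omega) hμ hμn
  have hp : 0 < critExp n μ := one_pos.trans (one_lt_critExp hn hμn)
  have hs := sobolevExp_pos hn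
  have hs' : ENNReal.ofReal (sobolevExp n) ≠ 0 := by simpa using hs
  refine ⟨C, fun Ω u M hΩ hu hM hle => ?_⟩
  -- The normalisation below divides by `M`, so `M = 0`, where `u` vanishes almost everywhere, is
  -- separate.
  rcases hM.eq_or_lt with rfl | hM
  · rw [ENNReal.ofReal_zero, nonpos_iff_eq_zero, eLpNorm_eq_zero_iff hu hs'] at hle
    rw [choquard_congr_ae (v := fun _ => 0) hle, choquard_zero hp.ne']
    exact bot_le
  set v : Eucl n → ℝ := Ω.indicator (hu.mk u) with hv
  have hvm : Measurable v := hu.stronglyMeasurable_mk.measurable.indicator hΩ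
  have hnorm : ∫⁻ x, ENNReal.ofReal ((|M⁻¹ * v x| ^ critExp n μ) ^ (2 * n / (2 * n - μ) : ℝ)) ≤
      1 := by
    have e : ∀ x, ENNReal.ofReal ((|M⁻¹ * v x| ^ critExp n μ) ^ (2 * n / (2 * n - μ) : ℝ)) =
        ‖M⁻¹ * v x‖ₑ ^ sobolevExp n := fun x => by
      rw [← Real.rpow_mul (abs_nonneg _), critExp_mul_eq_sobolevExp (by omega) hμn,
        ← ENNReal.ofReal_rpow_of_nonneg (abs_nonneg _) hs.le, Real.enorm_eq_ofReal_abs]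
    simp_rw [e]
    have h1 : eLpNorm (M⁻¹ • v) (ENNReal.ofReal (sobolevExp n)) volume ≤ 1 := by
      rw [eLpNorm_const_smul, hv, eLpNorm_indicator_eq_eLpNorm_restrict hΩ,
        ← eLpNorm_congr_ae hu.ae_eq_mk]
      calc _ ≤ ‖M⁻¹‖ₑ * ENNReal.ofReal M := by gcongr
        _ = 1 := by
          rw [Real.enorm_of_nonneg (by positivity), ← ENNReal.ofReal_mul (by positivity),
            inv_mul_cancel₀ hM.ne', ENNReal.ofReal_one]
    rw [eLpNorm_eq_lintegral_rpow_enorm_toReal hs' ENNReal.ofReal_ne_top,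
      ENNReal.toReal_ofReal hs.le] at h1
    by_contra! hlt
    exact absurd h1 (not_le.2 (ENNReal.one_lt_rpow hlt (by positivity)))
  have key := hC (fun x => |M⁻¹ * v x| ^ critExp n μ)
    ((measurable_const.mul hvm).abs.pow_const _) (fun x => by positivity) hnorm
  have hscale := choquard_const_mul μ univ (fun x => M⁻¹ * v x) hM
  have e1 : (fun x => M * (M⁻¹ * v x)) = v := by
    ext x; rw [mul_inv_cancel_left₀ hM.ne']
  rw [e1] at hscale
  rw [choquard_congr_ae hu.ae_eq_mk, choquard_eq_univ hΩ hp.ne']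
  have e2 : choquard μ univ v = ∫⁻ x, ∫⁻ y, ENNReal.ofReal (|v x| ^ critExp n μ *
      |v y| ^ critExp n μ / ‖x - y‖ ^ μ) := by
    simp [choquard]
  rw [← e2, hscale, mul_comm]
  gcongr
  simpa [choquard] using key

theorem ae_eq_zero_of_choquard_eq_zero {n : ℕ} (hn : 0 < n) {μ : ℝ} {Ω : Set (Eucl n)}
    {v : Eucl n → ℝ} (hvm : Measurable v) (h0 : choquard μ Ω v = 0) :
    ∀ᵐ x ∂volume.restrict Ω, v x = 0 := by
  have : Nonempty (Fin n) := ⟨⟨0, hn⟩⟩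
  set k : Eucl n → Eucl n → ℝ≥0∞ := fun x y =>
    ENNReal.ofReal (|v x| ^ critExp n μ * |v y| ^ critExp n μ / ‖x - y‖ ^ μ) with hk
  have hm : Measurable (Function.uncurry k) :=
    ((((hvm.comp measurable_fst).abs.pow_const _).mul
      ((hvm.comp measurable_snd).abs.pow_const _)).div
      ((measurable_fst.sub measurable_snd).norm.pow_const _)).ennreal_ofReal
  have hmx : ∀ x, Measurable (k x) := fun x => hm.comp measurable_prodMk_left
  have h1 := (lintegral_eq_zero_iff
    (Measurable.lintegral_prod_right (ν := volume.restrict Ω) hm)).1 h0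
  by_contra hv
  obtain ⟨x, hx, hvx⟩ : ∃ x, ∫⁻ y in Ω, k x y = 0 ∧ v x ≠ 0 := by
    by_contra! hcon
    refine hv ?_
    filter_upwards [h1] with x hx using hcon x hx
  have hx' := (lintegral_eq_zero_iff (hmx x)).1 hx
  refine hv ?_
  -- The diagonal is discarded because division by zero may make the integrand vanish there; points
  -- are null since `n > 0`.
  have hxy : ∀ᵐ y ∂volume.restrict Ω, y ≠ x := by
    refine ae_restrict_of_ae ?_
    simp [ae_iff]
  filter_upwards [hx', hxy] with y hy hyx
  by_contra hvy
  have hpos : 0 < |v x| ^ critExp n μ * |v y| ^ critExp n μ / ‖x - y‖ ^ μ := by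
    have h1 : 0 < ‖x - y‖ := norm_pos_iff.2 (sub_ne_zero.2 hyx.symm)
    have h2 := abs_pos.2 hvx
    have h3 := abs_pos.2 hvy
    positivity
  exact absurd (ENNReal.ofReal_eq_zero.1 hy) (not_le.2 hpos)

theorem choquard_ne_zero {n : ℕ} (hn : 0 < n) {μ : ℝ} {Ω : Set (Eucl n)} {u : Eucl n → ℝ}
    (hu : AEStronglyMeasurable u (volume.restrict Ω))
    (hne : ¬ ∀ᵐ x ∂volume.restrict Ω, u x = 0) : choquard μ Ω u ≠ 0 := by
  intro h0
  rw [choquard_congr_ae hu.ae_eq_mk] at h0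
  apply hne
  filter_upwards [ae_eq_zero_of_choquard_eq_zero hn hu.stronglyMeasurable_mk.measurable h0,
    hu.ae_eq_mk] with x h1 h2
  rw [h2, h1]

/-- The Sobolev bound is a hypothesis so that the lemma serves both `H¹₀(Ω)` and `H¹(ℝⁿ)`. -/
theorem exists_choquard_le_dirichlet {n : ℕ} (hn : 2 < n) {μ : ℝ} (hμ : 0 < μ) (hμn : μ < n)
    (K : ℝ≥0) : ∃ D : ℝ, 0 < D ∧ ∀ (Ω : Set (Eucl n)) (u : Eucl n → ℝ), MeasurableSet Ω →
      MemH1 Ω u → eLpNorm u (ENNReal.ofReal (sobolevExp n)) (volume.restrict Ω) ≤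
        K * eLpNorm (weakGrad Ω u) 2 (volume.restrict Ω) →
      choquard μ Ω u ≤ ENNReal.ofReal (D * dirichlet Ω u ^ critExp n μ) := by
  obtain ⟨C, hC⟩ := exists_choquard_le hn hμ hμn
  -- The summand `1` only ensures `D > 0`.
  refine ⟨C * K ^ (2 * critExp n μ) + 1, by positivity, fun Ω u hΩ hu hle => ?_⟩
  have hd := dirichlet_nonneg Ω u
  have h := hC Ω u (K * dirichlet Ω u ^ (1 / 2 : ℝ)) hΩ hu.1.1 (by positivity) (by
    rw [ENNReal.ofReal_mul (by positivity), ENNReal.ofReal_coe_nnreal, ← hu.eLpNorm_weakGrad]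
    exact hle)
  refine h.trans ?_
  rw [← ENNReal.ofReal_coe_nnreal, ← ENNReal.ofReal_mul (by positivity)]
  apply ENNReal.ofReal_le_ofReal
  rw [Real.mul_rpow (by positivity) (by positivity), ← Real.rpow_mul hd]
  have e : 1 / 2 * (2 * critExp n μ) = critExp n μ := by ring
  rw [e, ← mul_assoc]
  gcongr
  linarith

/-! ### Bump functions and positivity of `S_{H,L}` -/

/-- Smooth bumps supported in a nonempty open set. -/
theorem exists_isTestFun {n : ℕ} {Ω : Set (Eucl n)} (hΩ : IsOpen Ω) (hne : Ω.Nonempty) :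
    ∃ ψ : Eucl n → ℝ, IsTestFun Ω ψ ∧ (∀ x, 0 ≤ ψ x) ∧
      ¬ ∀ᵐ x ∂volume.restrict Ω, ψ x = 0 := by
  obtain ⟨x₀, hx₀⟩ := hne
  obtain ⟨r, hr, hball⟩ := Metric.isOpen_iff.1 hΩ x₀ hx₀
  let φ : ContDiffBump x₀ := ⟨r / 4, r / 2, by positivity, by linarith⟩
  refine ⟨φ, ⟨φ.contDiff, φ.hasCompactSupport, ?_⟩, fun x => φ.nonneg, fun h => ?_⟩
  · rw [φ.tsupport_eq]
    exact (Metric.closedBall_subset_ball (by simp only [φ]; linarith)).trans hball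
  · rw [ae_restrict_iff' hΩ.measurableSet] at h
    have hsub : Metric.ball x₀ (r / 4) ⊆ {x | ¬ (x ∈ Ω → φ x = 0)} := by
      intro x hx
      have h1 : φ x = 1 := φ.one_of_mem_closedBall (Metric.ball_subset_closedBall hx)
      have h2 : x ∈ Ω := hball (Metric.ball_subset_ball (by linarith) hx)
      simp [h1, h2]
    have h0 := measure_mono_null hsub h
    exact (Metric.measure_ball_pos volume x₀ (by positivity : 0 < r / 4)).ne' h0

theorem bestConst_pos {n : ℕ} (hn : 2 < n) {μ : ℝ} (hμ : 0 < μ) (hμn : μ < n) :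
    0 < bestConst n μ := by
  obtain ⟨K, hK⟩ := exists_sobolev_memH1_univ hn
  obtain ⟨D, hD, hle⟩ := exists_choquard_le_dirichlet hn hμ hμn K
  have hp := one_pos.trans (one_lt_critExp hn hμn)
  have hle' : ∀ u : Eucl n → ℝ, MemH1 univ u →
      choquard μ univ u ≤ ENNReal.ofReal (D * dirichlet univ u ^ critExp n μ) := fun u hu =>
    hle univ u MeasurableSet.univ hu (by simpa using hK u hu)
  obtain ⟨ψ, hψ, -, hψ0⟩ := exists_isTestFun (n := n) isOpen_univ univ_nonempty
  have hfin : choquard μ univ ψ ≠ ⊤ := ne_top_of_le_ne_top ENNReal.ofReal_ne_top (hle' ψ hψ.memH1)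
  have hpos : choquard μ univ ψ ≠ 0 := choquard_ne_zero (by omega) hψ.memH1.1.1 hψ0
  set c := (choquard μ univ ψ).toReal with hc
  have hcpos : 0 < c := ENNReal.toReal_pos hpos hfin
  -- The constraint set must be nonempty, since `sInf ∅ = 0` would destroy positivity; a rescaled
  -- bump lies in it.
  have hne : {a | ∃ u : Eucl n → ℝ, MemH1 univ u ∧ choquard μ univ u = 1 ∧
      a = dirichlet univ u}.Nonempty := by
    refine ⟨_, fun x => c ^ (-(1 / (2 * critExp n μ))) * ψ x, hψ.memH1.const_mul _, ?_, rfl⟩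
    rw [choquard_const_mul _ _ _ (by positivity), ← ENNReal.ofReal_toReal hfin, ← hc,
      ← ENNReal.ofReal_mul (by positivity), ← Real.rpow_mul hcpos.le]
    have e : -(1 / (2 * critExp n μ)) * (2 * critExp n μ) = -1 := by field_simp
    rw [e, Real.rpow_neg_one, inv_mul_cancel₀ hcpos.ne', ENNReal.ofReal_one]
  -- The constraint gives `1 ≤ D A^p`, that is `A ≥ D^(-1/p)`.
  refine lt_of_lt_of_le (b := D⁻¹ ^ (1 / critExp n μ)) (by positivity) (le_csInf hne ?_)
  rintro a ⟨u, hu, hu1, rfl⟩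
  have h := hle' u hu
  rw [hu1, ENNReal.one_le_ofReal] at h
  have hd := dirichlet_nonneg univ u
  have h2 : D⁻¹ ≤ dirichlet univ u ^ critExp n μ := by
    rwa [inv_le_iff_one_le_mul₀ hD, mul_comm]
  have h3 := Real.rpow_le_rpow (z := 1 / critExp n μ) (by positivity) h2 (by positivity)
  rwa [← Real.rpow_mul hd, mul_one_div_cancel hp.ne', Real.rpow_one] at h3

/-! ### The sublinear term -/

/-- Hölder and Sobolev for the sublinear term. -/
theorem exists_integral_rpow_le {n : ℕ} (hn : 2 < n) {q : ℝ} (hq : 0 < q) (hq1 : q < 1)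
    {Ω : Set (Eucl n)} (hΩ : Bornology.IsBounded Ω) (K : ℝ≥0) :
    ∃ D : ℝ, 0 < D ∧ ∀ u : Eucl n → ℝ, MemH1 Ω u →
      Integrable (fun x => |u x| ^ (1 - q)) (volume.restrict Ω) →
      eLpNorm u (ENNReal.ofReal (sobolevExp n)) (volume.restrict Ω) ≤
        K * eLpNorm (weakGrad Ω u) 2 (volume.restrict Ω) →
      ∫ x in Ω, |u x| ^ (1 - q) ≤ D * dirichlet Ω u ^ ((1 - q) / 2) := by
  have hq' : 0 < 1 - q := by linarith
  have hs := sobolevExp_pos hn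
  have hn' : (2 : ℝ) < n := by exact_mod_cast hn
  have hqs : 1 - q ≤ sobolevExp n := by
    rw [sobolevExp, le_div_iff₀ (by linarith)]
    nlinarith
  -- The power of the volume lost in passing from the Sobolev exponent down to `1 - q`.
  set e : ℝ := 1 / (1 - q) - 1 / sobolevExp n
  have he : 0 ≤ e := sub_nonneg.2 (one_div_le_one_div_of_le hq' hqs)
  set V : ℝ := (volume Ω).toReal ^ e with hV
  have hV0 : 0 ≤ V := by positivity
  refine ⟨(K * V) ^ (1 - q) + 1, by positivity, fun u hu hint hle => ?_⟩
  have hd := dirichlet_nonneg Ω u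
  have hB : 0 ≤ ∫ x in Ω, |u x| ^ (1 - q) := integral_nonneg fun x => by positivity
  have h1 := eLpNorm_le_eLpNorm_mul_rpow_measure_univ (μ := volume.restrict Ω)
    (ENNReal.ofReal_le_ofReal hqs) hu.1.1
  rw [eLpNorm_eq_lintegral_rpow_enorm_toReal (by simpa using hq') ENNReal.ofReal_ne_top,
    ENNReal.toReal_ofReal hq'.le, ENNReal.toReal_ofReal hs.le, Measure.restrict_apply_univ] at h1
  have h2 : ∫⁻ x in Ω, ‖u x‖ₑ ^ (1 - q) = ENNReal.ofReal (∫ x in Ω, |u x| ^ (1 - q)) := by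
    rw [ofReal_integral_eq_lintegral_ofReal hint (Eventually.of_forall fun x => by positivity)]
    refine lintegral_congr fun x => ?_
    rw [Real.enorm_eq_ofReal_abs, ENNReal.ofReal_rpow_of_nonneg (abs_nonneg _) hq'.le]
  have h3 : volume Ω ^ e = ENNReal.ofReal V := by
    rw [hV, ← ENNReal.ofReal_rpow_of_nonneg ENNReal.toReal_nonneg he,
      ENNReal.ofReal_toReal hΩ.measure_lt_top.ne]
  have h4 : ENNReal.ofReal ((∫ x in Ω, |u x| ^ (1 - q)) ^ (1 / (1 - q))) ≤
      ENNReal.ofReal (K * dirichlet Ω u ^ (1 / 2 : ℝ) * V) := by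
    rw [← ENNReal.ofReal_rpow_of_nonneg hB (by positivity), ← h2,
      ENNReal.ofReal_mul (by positivity), ENNReal.ofReal_mul (by positivity),
      ENNReal.ofReal_coe_nnreal, ← hu.eLpNorm_weakGrad, ← h3]
    refine h1.trans ?_
    gcongr
  rw [ENNReal.ofReal_le_ofReal_iff (by positivity)] at h4
  have h5 := Real.rpow_le_rpow (by positivity) h4 hq'.le
  rw [← Real.rpow_mul hB, one_div_mul_cancel hq'.ne', Real.rpow_one, mul_right_comm,
    Real.mul_rpow (by positivity) (by positivity), ← Real.rpow_mul hd] at h5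
  refine h5.trans ?_
  rw [one_div_mul_eq_div]
  gcongr
  linarith

/-! ### The one-variable equation -/

theorem strictConcaveOn_sub_rpow {A C γ : ℝ} (hC : 0 < C) (hγ : 1 < γ) :
    StrictConcaveOn ℝ (Ici 0) fun s : ℝ => s * A - s ^ γ * C := by
  refine ⟨convex_Ici 0, fun x hx y hy hxy a b ha hb hab => ?_⟩
  have h := (strictConvexOn_rpow hγ).2 hx hy hxy ha hb hab
  simp only [smul_eq_mul] at h ⊢
  nlinarith [mul_lt_mul_of_pos_right h hC]

/-- A strictly concave function takes no value three times. -/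
theorem eq_or_eq_of_strictConcaveOn {h : ℝ → ℝ} {S : Set ℝ} (hh : StrictConcaveOn ℝ S h)
    {x y z L : ℝ} (hx : x ∈ S) (hy : y ∈ S) (hz : z ∈ S) (hxL : h x = L) (hyL : h y = L)
    (hzL : h z = L) (hxy : x < y) : z = x ∨ z = y := by
  have key : ∀ {a b c : ℝ}, a ∈ S → c ∈ S → h a = L → h b = L → h c = L → a < b → b < c →
      False := by
    intro a b c ha hc haL hbL hcL hab hbc
    have := hh.lt_on_openSegment ha hc (hab.trans hbc).ne
      (by rw [openSegment_eq_Ioo (hab.trans hbc)]; exact ⟨hab, hbc⟩)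
    rw [haL, hbL, hcL, min_self] at this
    exact lt_irrefl _ this
  by_contra! hne
  rcases lt_or_gt_of_ne hne.1 with h1 | h1
  · exact key hz hy hzL hxL hyL h1 hxy
  · rcases lt_or_gt_of_ne hne.2 with h2 | h2
    · exact key hx hy hxL hzL hyL h1 h2
    · exact key hx hz hxL hyL hzL hxy h2

theorem rpow_sub_rpow_eq_mul {A C α β t : ℝ} (ht : 0 < t) :
    t ^ α * A - t ^ β * C = t ^ α * (A - t ^ (β - α) * C) := by
  rw [mul_sub, ← mul_assoc, ← Real.rpow_add ht, add_sub_cancel]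

/-- The equation `A t^α - C t^β = L` has exactly two positive solutions when `L` is positive and
below some value of the left side. -/
theorem encard_solutions_eq_two {A C α β L t₀ : ℝ} (hA : 0 < A) (hC : 0 < C) (hα : 0 < α)
    (hαβ : α < β) (hL : 0 < L) (ht₀ : 0 < t₀) (hlt : L < t₀ ^ α * A - t₀ ^ β * C) :
    {t : ℝ | 0 < t ∧ t ^ α * A - t ^ β * C = L}.encard = 2 := by
  set m : ℝ → ℝ := fun t => t ^ α * A - t ^ β * C with hm
  have hβ : 0 < β := hα.trans hαβ
  have hcont : Continuous m :=
    ((Real.continuous_rpow_const hα.le).mul_const A).sub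
      ((Real.continuous_rpow_const hβ.le).mul_const C)
  have hm0 : m 0 = 0 := by simp [hm, Real.zero_rpow hα.ne', Real.zero_rpow hβ.ne']
  -- The positive zero of `m`. Since `m ≤ 0` from there on, `t₀ < t₁`, and the intermediate value
  -- theorem on both sides of `t₀` yields the two solutions.
  set t₁ : ℝ := (A / C) ^ (1 / (β - α)) with ht₁def
  have hβα : 0 < β - α := sub_pos.2 hαβ
  have ht₁ : 0 < t₁ := by positivity
  have ht₁pow : t₁ ^ (β - α) = A / C := by
    rw [ht₁def, ← Real.rpow_mul (by positivity), one_div_mul_cancel hβα.ne', Real.rpow_one]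
  have hm1 : m t₁ = 0 := by
    simp only [hm]
    rw [rpow_sub_rpow_eq_mul ht₁, ht₁pow, div_mul_cancel₀ _ hC.ne', sub_self, mul_zero]
  have h01 : t₀ < t₁ := by
    by_contra! hge
    have h1 : A / C ≤ t₀ ^ (β - α) := by
      rw [← ht₁pow]; exact Real.rpow_le_rpow ht₁.le hge hβα.le
    have h2 : m t₀ ≤ 0 := by
      simp only [hm]
      rw [rpow_sub_rpow_eq_mul ht₀]
      refine mul_nonpos_of_nonneg_of_nonpos (by positivity) ?_
      rw [div_le_iff₀ hC] at h1
      linarith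
    exact absurd (hL.trans hlt) (not_lt.2 h2)
  obtain ⟨a, ⟨ha0, hat⟩, haL⟩ := intermediate_value_Ioo ht₀.le hcont.continuousOn
    (show L ∈ Ioo (m 0) (m t₀) from ⟨by rwa [hm0], hlt⟩)
  obtain ⟨b, ⟨hb0, hbt⟩, hbL⟩ := intermediate_value_Ioo' h01.le hcont.continuousOn
    (show L ∈ Ioo (m t₁) (m t₀) from ⟨by rwa [hm1], hlt⟩)
  have hab : a < b := hat.trans hb0
  have hset : {t : ℝ | 0 < t ∧ m t = L} = {a, b} := by
    ext t
    simp only [mem_ofPred_eq, mem_insert_iff, mem_singleton_iff]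
    constructor
    · rintro ⟨ht, htL⟩
      -- With `s = t^α` the function becomes `s A - s^(β/α) C`, strictly concave because `β/α > 1`;
      -- this excludes a third solution.
      have hconv := strictConcaveOn_sub_rpow (A := A) hC ((one_lt_div hα).2 hαβ)
      have hpow : ∀ {s : ℝ}, 0 < s → s ^ α * A - (s ^ α) ^ (β / α) * C = m s := fun hs => by
        rw [← Real.rpow_mul hs.le, mul_div_cancel₀ _ hα.ne']
      have hb := ht₀.trans hb0
      have hinj : ∀ {s r : ℝ}, 0 < s → 0 < r → s ^ α = r ^ α → s = r := fun hs hr h =>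
        (Real.rpow_left_inj hs.le hr.le hα.ne').1 h
      rcases eq_or_eq_of_strictConcaveOn hconv (x := a ^ α) (y := b ^ α) (z := t ^ α) (L := L)
        (by simp only [mem_Ici]; positivity) (by simp only [mem_Ici]; positivity)
        (by simp only [mem_Ici]; positivity) ((hpow ha0).trans haL) ((hpow hb).trans hbL)
        ((hpow ht).trans htL) (Real.rpow_lt_rpow ha0.le hab hα) with h | h
      · exact Or.inl (hinj ht ha0 h)
      · exact Or.inr (hinj ht hb h)
    · rintro (rfl | rfl)
      · exact ⟨ha0, haL⟩
      · exact ⟨ht₀.trans hb0, hbL⟩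
  rw [hset, encard_pair hab.ne]

/-! ### Derivatives and critical points of the fiber maps -/

section Fiber

variable {n : ℕ} {μ q l : ℝ} {Ω : Set (Eucl n)} {u : Eucl n → ℝ}

theorem fiber_eq (hΩ : IsOpen Ω) (hu : MemH1 Ω u) {t : ℝ} (ht : 0 < t) :
    fiber μ q Ω l u t = 1 / 2 * (t ^ 2 * dirichlet Ω u) -
      l / (1 - q) * (t ^ (1 - q) * ∫ x in Ω, |u x| ^ (1 - q)) -
      1 / (2 * critExp n μ) * (t ^ (2 * critExp n μ) * (choquard μ Ω u).toReal) := by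
  rw [fiber, energy, dirichlet_const_mul hΩ hu, choquard_const_mul _ _ _ ht, ENNReal.toReal_mul,
    ENNReal.toReal_ofReal (by positivity)]
  simp_rw [abs_mul, abs_of_pos ht, Real.mul_rpow ht.le (abs_nonneg _)]
  rw [integral_const_mul]

theorem hasDerivAt_fiber (hq1 : q < 1) (hp : 0 < critExp n μ) (hΩ : IsOpen Ω) (hu : MemH1 Ω u)
    {t : ℝ} (ht : 0 < t) :
    HasDerivAt (fiber μ q Ω l u) (t * dirichlet Ω u - l * t ^ (-q) * (∫ x in Ω, |u x| ^ (1 - q)) -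
      t ^ (2 * critExp n μ - 1) * (choquard μ Ω u).toReal) t := by
  have h1 : HasDerivAt (fun t : ℝ => t ^ 2) (2 * t) t := by simpa using hasDerivAt_pow 2 t
  have h2 := Real.hasDerivAt_rpow_const (x := t) (p := 1 - q) (Or.inl ht.ne')
  have h3 := Real.hasDerivAt_rpow_const (x := t) (p := 2 * critExp n μ) (Or.inl ht.ne')
  have h := (((h1.mul_const (dirichlet Ω u)).const_mul (1 / 2 : ℝ)).sub
    ((h2.mul_const (∫ x in Ω, |u x| ^ (1 - q))).const_mul (l / (1 - q)))).sub
    ((h3.mul_const (choquard μ Ω u).toReal).const_mul (1 / (2 * critExp n μ)))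
  have hq' : 1 - q ≠ 0 := by linarith
  refine (h.congr_of_eventuallyEq ?_).congr_deriv ?_
  · filter_upwards [eventually_gt_nhds ht] with s hs using fiber_eq hΩ hu hs
  · rw [sub_sub_cancel_left]
    field_simp

theorem deriv_deriv_fiber_one (hq1 : q < 1) (hp : 0 < critExp n μ) (hΩ : IsOpen Ω)
    (hu : MemH1 Ω u) :
    deriv (deriv (fiber μ q Ω l u)) 1 = dirichlet Ω u + q * l * (∫ x in Ω, |u x| ^ (1 - q)) -
      (2 * critExp n μ - 1) * (choquard μ Ω u).toReal := by
  have h2 := Real.hasDerivAt_rpow_const (x := (1 : ℝ)) (p := -q) (Or.inl one_ne_zero)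
  have h3 := Real.hasDerivAt_rpow_const (x := (1 : ℝ)) (p := 2 * critExp n μ - 1)
    (Or.inl one_ne_zero)
  have h := (((hasDerivAt_id (1 : ℝ)).mul_const (dirichlet Ω u)).sub
    ((h2.const_mul l).mul_const (∫ x in Ω, |u x| ^ (1 - q)))).sub
    (h3.mul_const (choquard μ Ω u).toReal)
  refine ((h.congr_of_eventuallyEq ?_).congr_deriv ?_).deriv
  · filter_upwards [eventually_gt_nhds one_pos] with s hs
      using (hasDerivAt_fiber hq1 hp hΩ hu hs).deriv
  · simp only [Real.one_rpow]
    ring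

/-- Multiplying the derivative by `t^q` isolates the singular term as the constant `λ B`. -/
theorem critPts_eq (hq1 : q < 1) (hp : 0 < critExp n μ) (hΩ : IsOpen Ω) (hu : MemH1 Ω u) :
    critPts μ q Ω l u = {t | 0 < t ∧ t ^ (1 + q) * dirichlet Ω u -
      t ^ (2 * critExp n μ - 1 + q) * (choquard μ Ω u).toReal =
        l * ∫ x in Ω, |u x| ^ (1 - q)} := by
  ext t
  simp only [critPts, mem_ofPred_eq]
  refine and_congr_right fun ht => ?_
  have hd := hasDerivAt_fiber (l := l) hq1 hp hΩ hu ht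
  have e : t ^ (1 + q) * dirichlet Ω u - t ^ (2 * critExp n μ - 1 + q) * (choquard μ Ω u).toReal -
      l * ∫ x in Ω, |u x| ^ (1 - q) = t ^ q * (t * dirichlet Ω u -
        l * t ^ (-q) * (∫ x in Ω, |u x| ^ (1 - q)) -
        t ^ (2 * critExp n μ - 1) * (choquard μ Ω u).toReal) := by
    have h0 : t ^ q ≠ 0 := by positivity
    rw [Real.rpow_add ht, Real.rpow_add ht, Real.rpow_one, Real.rpow_neg ht.le]
    field_simp
    ring
  constructor
  · intro h
    rw [← sub_eq_zero, e, hd.unique h, mul_zero]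
  · intro h
    rw [← sub_eq_zero, e, mul_eq_zero, or_iff_right (by positivity)] at h
    rwa [h] at hd

end Fiber

/-! ### The set of admissible parameters -/

theorem MemHPlus.integral_pos {n : ℕ} {q : ℝ} (hq1 : q < 1) {Ω : Set (Eucl n)} {u : Eucl n → ℝ}
    (hu : MemHPlus q Ω u) : 0 < ∫ x in Ω, |u x| ^ (1 - q) := by
  have h0 : 0 ≤ fun x => |u x| ^ (1 - q) := fun x => by positivity
  refine lt_of_le_of_ne (integral_nonneg h0) fun h => hu.ne_zero ?_
  have := (integral_eq_zero_iff_of_nonneg h0 hu.integrable).1 h.symm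
  filter_upwards [this] with x hx
  have h1 : |u x| ^ (1 - q) = 0 := hx
  rw [Real.rpow_eq_zero (abs_nonneg _) (by linarith)] at h1
  exact abs_eq_zero.1 h1

theorem dirichlet_pos {n : ℕ} (hn : 2 < n) {Ω : Set (Eucl n)} {u : Eucl n → ℝ} {K : ℝ≥0}
    (hu : MemH1 Ω u) (hne : ¬ ∀ᵐ x ∂volume.restrict Ω, u x = 0)
    (hle : eLpNorm u (ENNReal.ofReal (sobolevExp n)) (volume.restrict Ω) ≤
        K * eLpNorm (weakGrad Ω u) 2 (volume.restrict Ω)) : 0 < dirichlet Ω u := by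
  refine lt_of_le_of_ne (dirichlet_nonneg Ω u) fun h => hne ?_
  rw [hu.eLpNorm_weakGrad, ← h, Real.zero_rpow (by norm_num), ENNReal.ofReal_zero, mul_zero,
    nonpos_iff_eq_zero, eLpNorm_eq_zero_iff hu.1.1 (by simpa using sobolevExp_pos hn)] at hle
  exact hle

theorem bddAbove_admissible {n : ℕ} (hn : 2 < n) {μ q : ℝ} (hμ : 0 < μ) (hμn : μ < n)
    (hq : 0 < q) (hq1 : q < 1) {Ω : Set (Eucl n)} (hΩ : IsOpen Ω) {u : Eucl n → ℝ}
    (hu : MemHPlus q Ω u) : BddAbove (admissible μ q Ω) := by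
  have hp1 := one_lt_critExp hn hμn
  have hp : 0 < critExp n μ := one_pos.trans hp1
  obtain ⟨K, hK⟩ := exists_sobolev_memH10 hn
  obtain ⟨D, hD, hle⟩ := exists_choquard_le_dirichlet hn hμ hμn K
  have hB := hu.integral_pos hq1
  have hA := dirichlet_pos hn hu.memH10.1 hu.ne_zero (hK Ω u hu.memH10)
  have hC : 0 < (choquard μ Ω u).toReal := ENNReal.toReal_pos
    (choquard_ne_zero (by omega) hu.memH10.1.1.1 hu.ne_zero)
    (ne_top_of_le_ne_top ENNReal.ofReal_ne_top
      (hle Ω u hΩ.measurableSet hu.memH10.1 (hK Ω u hu.memH10)))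
  set A := dirichlet Ω u
  set B := ∫ x in Ω, |u x| ^ (1 - q)
  set C := (choquard μ Ω u).toReal
  refine ⟨((A / C) ^ (1 / (2 * critExp n μ - 2))) ^ (1 + q) * A / B, fun l hl => ?_⟩
  obtain ⟨hl0, h2, -⟩ := hl
  obtain ⟨t, ht⟩ : (critPts μ q Ω l u).Nonempty := by
    rw [← encard_ne_zero, h2 u hu]; norm_num
  rw [critPts_eq hq1 hp hΩ hu.memH10.1] at ht
  obtain ⟨ht0, hteq⟩ := ht
  change t ^ (1 + q) * A - t ^ (2 * critExp n μ - 1 + q) * C = l * B at hteq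
  have hpos : 0 < l * B := by positivity
  have hexp : 2 * critExp n μ - 1 + q - (1 + q) = 2 * critExp n μ - 2 := by ring
  have hteq' := hteq
  rw [rpow_sub_rpow_eq_mul ht0, hexp] at hteq'
  -- Positivity of `λ B` confines `t` below the zero of the left side, independently of `λ`.
  have h3 : 0 < A - t ^ (2 * critExp n μ - 2) * C := by
    rw [← hteq'] at hpos
    exact pos_of_mul_pos_right hpos (by positivity)
  have h4 : t ≤ (A / C) ^ (1 / (2 * critExp n μ - 2)) := by
    have h5 : t ^ (2 * critExp n μ - 2) ≤ A / C := by
      rw [le_div_iff₀ hC]; linarith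
    have h6 := Real.rpow_le_rpow (z := 1 / (2 * critExp n μ - 2)) (by positivity) h5
      (one_div_nonneg.2 (by linarith))
    rwa [← Real.rpow_mul ht0.le, mul_one_div_cancel (by linarith), Real.rpow_one] at h6
  rw [le_div_iff₀ hB, ← hteq]
  have h7 : t ^ (1 + q) * A ≤ ((A / C) ^ (1 / (2 * critExp n μ - 2))) ^ (1 + q) * A := by
    gcongr
  have h8 : 0 ≤ t ^ (2 * critExp n μ - 1 + q) * C := by positivity
  linarith

theorem exists_mem_admissible {n : ℕ} (hn : 2 < n) {μ q : ℝ} (hμ : 0 < μ) (hμn : μ < n)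
    (hq : 0 < q) (hq1 : q < 1) {Ω : Set (Eucl n)} (hΩ : IsOpen Ω)
    (hΩb : Bornology.IsBounded Ω) : ∃ l ∈ admissible μ q Ω, 0 < l := by
  have hp1 := one_lt_critExp hn hμn
  have hp : 0 < critExp n μ := one_pos.trans hp1
  obtain ⟨K, hK⟩ := exists_sobolev_memH10 hn
  obtain ⟨D, hD, hCle⟩ := exists_choquard_le_dirichlet hn hμ hμn K
  obtain ⟨E, hE, hBle⟩ := exists_integral_rpow_le hn hq hq1 hΩb K
  have hS := bestConst_pos hn hμ hμn
  set p := critExp n μ with hpdef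
  set T : ℝ := (p * bestConst n μ ^ p) ^ (1 / (p - 1)) with hT
  have hTpos : 0 < T := by positivity
  -- Chosen so that `τ^(2p-2) = 1/(2D)`: at `t₀ = τ A^(-1/2)` the nonlocal term then absorbs at most
  -- half of `A`.
  set τ : ℝ := (2 * D) ^ (-(1 / (2 * p - 2))) with hτ
  have hτpos : 0 < τ := by positivity
  have hc : 0 < (2 * p - 1 + q) / (2 * p - 2) := div_pos (by linarith) (by linarith)
  set c := (2 * p - 1 + q) / (2 * p - 2) with hcdef
  -- The first entry secures (a), its extra factor `2` giving a strict inequality; the second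
  -- secures (b).
  set l : ℝ := min (τ ^ (1 + q) / 2 / (2 * E)) (T ^ ((1 + q) / 2) / (c * E)) with hl
  have hlpos : 0 < l := by positivity
  have hl1 : l * E < τ ^ (1 + q) / 2 := by
    have h1 : l * (2 * E) ≤ τ ^ (1 + q) / 2 := by
      rw [← le_div_iff₀ (by positivity)]; exact min_le_left _ _
    have : 0 < l * E := by positivity
    linarith
  have hl2 : c * (l * E) ≤ T ^ ((1 + q) / 2) := by
    have h1 : l * (c * E) ≤ T ^ ((1 + q) / 2) := by
      rw [← le_div_iff₀ (by positivity)]; exact min_le_right _ _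
    linarith
  refine ⟨l, ⟨hlpos, fun u hu => ?_, sSup_le ?_⟩, hlpos⟩
  · have hB := hu.integral_pos hq1
    have hsob := hK Ω u hu.memH10
    have hA := dirichlet_pos hn hu.memH10.1 hu.ne_zero hsob
    have hCE := hCle Ω u hΩ.measurableSet hu.memH10.1 hsob
    have hC : 0 < (choquard μ Ω u).toReal := ENNReal.toReal_pos
      (choquard_ne_zero (by omega) hu.memH10.1.1.1 hu.ne_zero)
      (ne_top_of_le_ne_top ENNReal.ofReal_ne_top hCE)
    have hCD : (choquard μ Ω u).toReal ≤ D * dirichlet Ω u ^ p :=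
      ENNReal.toReal_le_of_le_ofReal (by positivity) hCE
    have hBE := hBle u hu.memH10.1 hu.integrable hsob
    rw [critPts_eq hq1 hp hΩ hu.memH10.1]
    set A := dirichlet Ω u
    set B := ∫ x in Ω, |u x| ^ (1 - q)
    set C := (choquard μ Ω u).toReal
    have ht₀ : 0 < τ * A ^ (-(1 / 2) : ℝ) := by positivity
    refine encard_solutions_eq_two (t₀ := τ * A ^ (-(1 / 2) : ℝ)) hA hC (by linarith)
      (by linarith) (by positivity) ht₀ ?_
    have hexp : 2 * p - 1 + q - (1 + q) = 2 * p - 2 := by ring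
    rw [rpow_sub_rpow_eq_mul ht₀, hexp]
    have h1 : (τ * A ^ (-(1 / 2) : ℝ)) ^ (2 * p - 2) = (2 * D)⁻¹ * A ^ (1 - p) := by
      rw [Real.mul_rpow hτpos.le (by positivity), ← Real.rpow_mul hA.le, hτ,
        ← Real.rpow_mul (by positivity), ← Real.rpow_neg_one (2 * D)]
      have : 2 * p - 2 ≠ 0 := by linarith
      have e1 : -(1 / (2 * p - 2)) * (2 * p - 2) = -1 := by
        rw [neg_mul, one_div_mul_cancel this]
      have e2 : -(1 / 2) * (2 * p - 2) = 1 - p := by ring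
      rw [e1, e2]
    have h2 : (τ * A ^ (-(1 / 2) : ℝ)) ^ (2 * p - 2) * C ≤ A / 2 := by
      rw [h1]
      calc (2 * D)⁻¹ * A ^ (1 - p) * C ≤ (2 * D)⁻¹ * A ^ (1 - p) * (D * A ^ p) := by gcongr
        _ = (2 * D)⁻¹ * D * (A ^ (1 - p) * A ^ p) := by ring
        _ = A / 2 := by
          rw [← Real.rpow_add hA, sub_add_cancel, Real.rpow_one]
          field_simp
    have h3 : (τ * A ^ (-(1 / 2) : ℝ)) ^ (1 + q) * (A / 2) =
        τ ^ (1 + q) / 2 * A ^ ((1 - q) / 2) := by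
      have e : A ^ ((1 - q) / 2) = A ^ (-(1 / 2) * (1 + q)) * A := by
        rw [← Real.rpow_add_one hA.ne']; congr 1; ring
      rw [Real.mul_rpow hτpos.le (by positivity), ← Real.rpow_mul hA.le, e]
      ring
    calc l * B ≤ l * (E * A ^ ((1 - q) / 2)) := by gcongr
      _ = l * E * A ^ ((1 - q) / 2) := by ring
      _ < τ ^ (1 + q) / 2 * A ^ ((1 - q) / 2) := by gcongr
      _ = (τ * A ^ (-(1 / 2) : ℝ)) ^ (1 + q) * (A / 2) := h3.symm
      _ ≤ _ := by gcongr; linarith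
  · rintro _ ⟨u, ⟨hu, hd1, hd2⟩, rfl⟩
    simp only [EReal.coe_le_coe_iff]
    have hsob := hK Ω u hu.memH10
    have hA := dirichlet_pos hn hu.memH10.1 hu.ne_zero hsob
    have hBE := hBle u hu.memH10.1 hu.integrable hsob
    rw [deriv_deriv_fiber_one hq1 hp hΩ hu.memH10.1] at hd2
    have h0 := (hasDerivAt_fiber (l := l) hq1 hp hΩ hu.memH10.1 one_pos).unique hd1
    simp only [Real.one_rpow, one_mul, mul_one] at h0
    rw [← hpdef] at hd2
    set A := dirichlet Ω u
    set B := ∫ x in Ω, |u x| ^ (1 - q)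
    set C := (choquard μ Ω u).toReal
    -- `φ_u'(1) = 0` eliminates the nonlocal term from `φ_u''(1) > 0`.
    have hCeq : C = A - l * B := by linarith
    have h1 : (2 * p - 2) * A < (2 * p - 1 + q) * (l * B) := by
      rw [hCeq] at hd2
      nlinarith
    have h2 : A < c * (l * B) := by
      rw [hcdef, div_mul_eq_mul_div, lt_div_iff₀ (by linarith)]
      linarith
    have h3 : A < c * (l * E) * A ^ ((1 - q) / 2) := by
      refine h2.trans_le ?_
      calc c * (l * B) ≤ c * (l * (E * A ^ ((1 - q) / 2))) := by gcongr
        _ = _ := by ring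
    -- Cancelling `A^((1-q)/2)` leaves a positive power of `A`, which bounds the Dirichlet integral.
    have h4 : A ^ ((1 + q) / 2) < c * (l * E) := by
      have e : A ^ ((1 + q) / 2) * A ^ ((1 - q) / 2) = A := by
        rw [← Real.rpow_add hA]
        have : (1 + q) / 2 + (1 - q) / 2 = 1 := by ring
        rw [this, Real.rpow_one]
      exact lt_of_mul_lt_mul_right (e.le.trans_lt h3) (by positivity)
    exact ((Real.rpow_lt_rpow_iff hA.le hTpos.le (by linarith : 0 < (1 + q) / 2)).1
      (h4.trans_le hl2)).le

end Choquard

end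

theorem mainTheorem9 (n : ℕ) (hn : 2 < n) (μ q : ℝ) (hμ : 0 < μ) (hμn : μ < n)
    (hq : 0 < q) (hq1 : q < 1) (Ω : Set (Choquard.Eucl n)) (hΩ_open : IsOpen Ω)
    (hΩ_conn : IsConnected Ω) (hΩ_bdd : Bornology.IsBounded Ω) :
    IsLUB (Choquard.admissible μ q Ω) (Choquard.threshold μ q Ω) ∧
      0 < Choquard.threshold μ q Ω := by
  obtain ⟨l, hl, hlpos⟩ :=
    Choquard.exists_mem_admissible hn hμ hμn hq hq1 hΩ_open hΩ_bdd
  -- Boundedness needs an actual element of `H_{+,q}`; otherwise (a) would be vacuous.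
  obtain ⟨ψ, hψ, hψ0, hψne⟩ := Choquard.exists_isTestFun hΩ_open hΩ_conn.nonempty
  have hmem : Choquard.MemHPlus q Ω ψ := by
    refine ⟨hψ.memH10 hΩ_open, Filter.Eventually.of_forall hψ0, hψne, ?_⟩
    refine Integrable.restrict (Continuous.integrable_of_hasCompactSupport ?_ ?_)
    · exact hψ.smooth.continuous.abs.rpow_const fun x => Or.inr (by linarith)
    · refine hψ.compactSupport.comp_left (g := fun s : ℝ => |s| ^ (1 - q)) ?_
      rw [abs_zero, Real.zero_rpow (by linarith)]
  have hbdd := Choquard.bddAbove_admissible (μ := μ) hn hμ hμn hq hq1 hΩ_open hmem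
  exact ⟨isLUB_csSup ⟨l, hl⟩ hbdd, hlpos.trans_le (le_csSup hbdd hl)⟩
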